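/- Let $k\ge 0$ and let $\Lambda$ be a $k$-graph: a small category with object set $\Lambda^0$, range and source maps $r,s$, and a degree functor $d:\Lambda\to\mathbb N^k$ with the unique factorisation property (if $d(\lambda)=m+n$, then $\lambda=\mu\nu$ for unique $\mu,\nu$ with $d(\mu)=m$, $d(\nu)=n$). Assume that $\Lambda$ is row-finite with no sources, i.e. for all $v\in\Lambda^0$ and $n\in\mathbb N^k$ the set $v\Lambda^n=\{\lambda: r(\lambda)=v,\ d(\lambda)=n\}$ is finite and non-empty. Let $\Lambda^\infty$ be the set of infinite paths (degree-preserving functors $x:\Omega_k\to\Lambda$, where $\Omega_k$ has object set $\mathbb N^k$ and exactly one morphism $(m,n)$, of range $m$, source $n$ and degree $n-m$, for each pair $m\le n$), with shifts $(\sigma^p x)(m,n)=x(m+p,n+p)$. Let $$G_\Lambda=\{(x,l-m,y): x,y\in\Lambda^\infty,\ l,m\in\mathbb N^k,\ \sigma^l x=\sigma^m y\}$$ be the path groupoid, with $r(x,n,y)=x$, $s(x,n,y)=y$, $(x,n,y)(y,m,z)=(x,n+m,z)$, $(x,n,y)^{-1}=(y,-n,x)$, and the topology generated by the sets $Z(\lambda,\mu)=\{(\lambda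 z,d(\lambda)-d(\mu),\mu z): z\in\Lambda^\infty,\ r(z)=s(\lambda)\}$ with $s(\lambda)=s(\mu)$. Let $A(G_\Lambda)$ be the complex algebra of compactly supported, locally constant functions $G_\Lambda\to\mathbb C$ with the convolution $(f*g)(\gamma)=\sum_{r(\alpha)=r(\gamma)}f(\alpha)g(\alpha^{-1}\gamma)$, in which all sums have only finitely many non-zero terms. Let $\mathrm{KP}(\Lambda,\mathbb C)$ be the Kumjian–Pask algebra: the universal (not necessarily unital) complex algebra generated by $p_v$ ($v\in\Lambda^0$) and $s_\lambda,s_{\lambda^*}$ ($\lambda\in\Lambda$), where $s_v=s_{v^*}=p_v$ for identities $v$, subject to: the $p_v$ are mutually orthogonal idempotents; $s_\lambda s_\mu=s_{\lambda\mu}$ and $s_{\mu^*}s_{\lambda^*}=s_{(\lambda\mu)^*}$ if $s(\lambda)=r(\mu)$; $p_{r(\lambda)}s_\lambda=s_\lambda=s_\lambda p_{s(\lambda)}$ and $p_{s(\lambda)}s_{\lambda^*}=s_{\lambda^*}=s_{\lambda^*}p_{r(\lambda)}$; $s_{\lambda^*}s_\mu=\delta_{\lambda,\mu}p_{s(\lambda)}$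 if $d(\lambda)=d(\mu)$; and $p_v=\sum_{\lambda\in v\Lambda^n}s_\lambda s_{\lambda^*}$ for all $v\in\Lambda^0$, $n\in\mathbb N^k$. Then $A(G_\Lambda)$ is isomorphic to $\mathrm{KP}(\Lambda,\mathbb C)$ as a complex algebra; more precisely, there is an isomorphism $\mathrm{KP}(\Lambda,\mathbb C)\to A(G_\Lambda)$ with $p_v\mapsto 1_{Z(v,v)}$, $s_\lambda\mapsto 1_{Z(\lambda,s(\lambda))}$ and $s_{\lambda^*}\mapsto 1_{Z(s(\lambda),\lambda)}$. If $k=1$, let $E=(\Lambda^0,\Lambda^1,r,s)$ be the directed graph whose edges are the elements of $\Lambda$ of degree $1$, and let $L_{\mathbb C}(E)$ be its Leavitt path algebra: the universal (not necessarily unital) complex algebra generated by mutually orthogonal idempotents $v\in E^0$ and elements $e,e^*$ ($e\in E^1$) with $r(e)e=e=e\,s(e)$, $s(e)e^*=e^*=e^*r(e)$, $e^*f=\delta_{e,f}s(e)$, and $v=\sum_{r(e)=v}ee^*$ for every $v$ that receives a finite non-zero number of edges. Then there is an isomorphism of complex algebras $L_{\mathbb C}(E)\to A(G_\Lambda)$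 with $v\mapsto 1_{Z(v,v)}$, $e\mapsto 1_{Z(e,s(e))}$ and $e^*\mapsto 1_{Z(s(e),e)}$. -/

import Mathlib

universe u v w

set_option linter.checkUnivs false

/-! ### Higher-rank graphs -/

/-- A `k`-graph: a small category, presented by its set `Vert` of objects, its set `Path` of
morphisms, range and source maps `r, s`, identities, and a composition `comp lam mu` (written
`λμ` in the literature) that is defined when `s lam = r mu`, together with a degree functor
`d` to `ℕ^k` which has the unique factorisation property. -/
structure KGraph (k : ℕ) where
  Vert : Type u
  Path : Type v
  r : Path → Vert
  s : Path → Vert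
  one : Vert → Path
  comp : (lam mu : Path) → s lam = r mu → Path
  r_one : ∀ a, r (one a) = a
  s_one : ∀ a, s (one a) = a
  r_comp : ∀ lam mu h, r (comp lam mu h) = r lam
  s_comp : ∀ lam mu h, s (comp lam mu h) = s mu
  one_comp : ∀ lam, comp (one (r lam)) lam (s_one _) = lam
  comp_one : ∀ lam, comp lam (one (s lam)) (r_one _).symm = lam
  assoc : ∀ lam mu nu (h : s lam = r mu) (h' : s mu = r nu),
    comp (comp lam mu h) nu ((s_comp _ _ _).trans h') =
      comp lam (comp mu nu h') (h.trans (r_comp _ _ _).symm)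
  d : Path → (Fin k → ℕ)
  d_one : ∀ a, d (one a) = 0
  d_comp : ∀ lam mu h, d (comp lam mu h) = d lam + d mu
  factorisation : ∀ (lam : Path) (m n : Fin k → ℕ), d lam = m + n →
    ∃! p : Path × Path, ∃ h : s p.1 = r p.2, d p.1 = m ∧ d p.2 = n ∧ comp p.1 p.2 h = lam

namespace KGraph

variable {k : ℕ} (Λ : KGraph.{u, v} k)

/-- `vΛⁿ`: the paths of degree `n` with range `a`. -/
def pathsFrom (a : Λ.Vert) (n : Fin k → ℕ) : Set Λ.Path := {lam | Λ.r lam = a ∧ Λ.d lam = n}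

/-- `Λ` is row-finite if every `vΛⁿ` is finite. -/
def RowFinite : Prop := ∀ a n, (Λ.pathsFrom a n).Finite

/-- `Λ` has no sources if every `vΛⁿ` is non-empty. -/
def NoSources : Prop := ∀ a n, (Λ.pathsFrom a n).Nonempty

/-- An infinite path: a degree-preserving functor `x : Ω_k → Λ`, where `Ω_k` has the objects
`ℕ^k` and exactly one morphism `(m, n)`, of range `m`, source `n` and degree `n - m`, for every
pair `m ≤ n`. -/
@[ext] structure InfPath where
  obj : (Fin k → ℕ) → Λ.Vert
  map : (m n : Fin k → ℕ) → m ≤ n → Λ.Path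
  r_map : ∀ m n h, Λ.r (map m n h) = obj m
  s_map : ∀ m n h, Λ.s (map m n h) = obj n
  map_self : ∀ m, map m m le_rfl = Λ.one (obj m)
  map_comp : ∀ l m n (h : l ≤ m) (h' : m ≤ n),
    Λ.comp (map l m h) (map m n h') ((s_map _ _ _).trans (r_map _ _ _).symm) =
      map l n (h.trans h')
  d_map : ∀ m n h, m + Λ.d (map m n h) = n

variable {Λ}

/-- The initial segment `x(0, n)` of an infinite path. -/
def InfPath.seg (x : Λ.InfPath) (n : Fin k → ℕ) : Λ.Path := x.map 0 n (fun _ => Nat.zero_le _)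

/-- The shift `σ^p`, with `(σ^p x)(m, n) = x(m + p, n + p)`. -/
def InfPath.shift (p : Fin k → ℕ) (x : Λ.InfPath) : Λ.InfPath where
  obj m := x.obj (m + p)
  map m n h := x.map (m + p) (n + p) (add_le_add_left h p)
  r_map _ _ _ := x.r_map _ _ _
  s_map _ _ _ := x.s_map _ _ _
  map_self _ := x.map_self _
  map_comp _ _ _ _ _ := x.map_comp _ _ _ _ _
  d_map m n h := by
    have := x.d_map (m + p) (n + p) (add_le_add_left h p)
    rw [add_right_comm] at this
    exact add_right_cancel this

theorem InfPath.shift_shift (p q : Fin k → ℕ) (x : Λ.InfPath) :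
    (x.shift q).shift p = x.shift (p + q) := by
  ext <;> simp [InfPath.shift, add_assoc]

variable (Λ)

/-- The `k`-graph groupoid `G_Λ`, as the set of triples `(x, n, y)` of two infinite paths and
`n ∈ ℤ^k` with `σ^l x = σ^m y` and `n = l - m` for some `l, m ∈ ℕ^k`. -/
@[ext] structure PathGroupoid where
  rng : Λ.InfPath
  lag : Fin k → ℤ
  src : Λ.InfPath
  tail : ∃ l m : Fin k → ℕ, rng.shift l = src.shift m ∧ ∀ i, lag i = (l i : ℤ) - (m i : ℤ)

variable {Λ}

/-- `Z(λ, μ) = {(λz, d(λ) - d(μ), μz) : z ∈ Λ^∞, r(z) = s(λ)}` for `s(λ) = s(μ)`; here `x = λz`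
is expressed by `x(0, d(λ)) = λ` and `σ^{d(λ)} x = z`. -/
def cylinder (lam mu : Λ.Path) : Set Λ.PathGroupoid :=
  {g | g.rng.seg (Λ.d lam) = lam ∧ g.src.seg (Λ.d mu) = mu ∧
    g.rng.shift (Λ.d lam) = g.src.shift (Λ.d mu) ∧
    ∀ i, g.lag i = (Λ.d lam i : ℤ) - (Λ.d mu i : ℤ)}

/-- The topology of `G_Λ` is generated by the sets `Z(λ, μ)` with `s(λ) = s(μ)`. -/
instance : TopologicalSpace Λ.PathGroupoid :=
  TopologicalSpace.generateFrom {Z | ∃ lam mu, Λ.s lam = Λ.s mu ∧ Z = cylinder lam mu}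

end KGraph

/-! ### Groupoids and the algebra `A(G)` -/

/-- A groupoid, presented by its set `G` of arrows and its set `X` of units; the product
`mul a b` is defined when `s a = r b`. -/
structure ArrowGroupoid (G : Type u) (X : Type v) where
  r : G → X
  s : G → X
  unit : X → G
  mul : (a b : G) → s a = r b → G
  inv : G → G
  r_unit : ∀ x, r (unit x) = x
  s_unit : ∀ x, s (unit x) = x
  r_mul : ∀ a b h, r (mul a b h) = r a
  s_mul : ∀ a b h, s (mul a b h) = s b
  r_inv : ∀ a, r (inv a) = s a
  s_inv : ∀ a, s (inv a) = r a
  unit_mul : ∀ a, mul (unit (r a)) a (s_unit _) = a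
  mul_unit : ∀ a, mul a (unit (s a)) (r_unit _).symm = a
  assoc : ∀ a b c (h : s a = r b) (h' : s b = r c),
    mul (mul a b h) c ((s_mul _ _ _).trans h') = mul a (mul b c h') (h.trans (r_mul _ _ _).symm)
  inv_mul : ∀ a, mul (inv a) a (s_inv a) = unit (s a)
  mul_inv : ∀ a, mul a (inv a) (r_inv a).symm = unit (r a)

/-- The convolution `(f * g)(γ) = ∑_{r(α) = r(γ)} f(α) g(α⁻¹γ)`. -/
noncomputable def ArrowGroupoid.conv {G : Type u} {X : Type v} (𝒢 : ArrowGroupoid G X)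
    (f g : G → ℂ) (c : G) : ℂ :=
  ∑ᶠ a : {a : G // 𝒢.r a = 𝒢.r c}, f a * g (𝒢.mul (𝒢.inv a) c ((𝒢.s_inv a).trans a.2))

/-- The complex vector space `A(G)` of compactly supported, locally constant functions `G → ℂ`
(these are automatically continuous). -/
def leavittGroupoidAlgebra (G : Type u) [TopologicalSpace G] : Submodule ℂ (G → ℂ) where
  carrier := {f | IsLocallyConstant f ∧ HasCompactSupport f}
  zero_mem' := ⟨IsLocallyConstant.const 0, HasCompactSupport.zero⟩
  add_mem' hf hg := ⟨hf.1.add hg.1, hf.2.add hg.2⟩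
  smul_mem' c f hf := ⟨hf.1.comp (fun z => c * z), hf.2.mono fun x hx h0 => hx (by simp [h0])⟩

/-- A linear bijection of a complex algebra `B` onto `A(G)` is an isomorphism of algebras if it
carries the product of `B` to convolution. Every sum that occurs in a convolution of elements of
`A(G)` is required to be finite. -/
def ArrowGroupoid.IsAlgebraIso {G : Type u} [TopologicalSpace G] {X : Type v}
    (𝒢 : ArrowGroupoid G X) {B : Type w} [NonUnitalRing B] [Module ℂ B]
    (φ : B ≃ₗ[ℂ] leavittGroupoidAlgebra G) : Prop :=
  (∀ f ∈ leavittGroupoidAlgebra G, ∀ x : X, {a | 𝒢.r a = x ∧ f a ≠ 0}.Finite) ∧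
  ∀ a b : B, (φ (a * b) : G → ℂ) = 𝒢.conv (φ a : G → ℂ) (φ b : G → ℂ)

/-- The groupoid structure of `G_Λ`: `r(x, n, y) = x`, `s(x, n, y) = y`,
`(x, n, y)(y, m, z) = (x, n + m, z)` and `(x, n, y)⁻¹ = (y, -n, x)`. -/
def KGraph.groupoid {k : ℕ} (Λ : KGraph.{u, v} k) : ArrowGroupoid Λ.PathGroupoid Λ.InfPath where
  r g := g.rng
  s g := g.src
  unit x := ⟨x, 0, x, 0, 0, rfl, by simp⟩
  mul a b h := ⟨a.rng, a.lag + b.lag, b.src, by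
    obtain ⟨l, m, h1, h2⟩ := a.tail
    obtain ⟨l', m', h3, h4⟩ := b.tail
    refine ⟨l' + l, m + m', ?_, fun i => ?_⟩
    · rw [← KGraph.InfPath.shift_shift, h1, h, KGraph.InfPath.shift_shift, add_comm,
        ← KGraph.InfPath.shift_shift, h3, KGraph.InfPath.shift_shift]
    · simp only [Pi.add_apply, h2, h4]; push_cast; ring⟩
  inv a := ⟨a.src, -a.lag, a.rng, by
    obtain ⟨l, m, h1, h2⟩ := a.tail
    exact ⟨m, l, h1.symm, fun i => by simp [h2]⟩⟩
  r_unit _ := rfl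
  s_unit _ := rfl
  r_mul _ _ _ := rfl
  s_mul _ _ _ := rfl
  r_inv _ := rfl
  s_inv _ := rfl
  unit_mul a := by ext1 <;> simp
  mul_unit a := by ext1 <;> simp
  assoc a b c h h' := by ext1 <;> simp [add_assoc]
  inv_mul a := by ext1 <;> simp
  mul_inv a := by ext1 <;> simp

/-! ### Algebras given by generators and relations -/

/-- The (not necessarily unital) complex algebra given by generators `X` and relations `R`: the
non-unital subalgebra generated by `X` in the unital algebra given by these generators and
relations. When the relations have no constant terms, it is the universal complex algebra, among
all complex algebras with or without unit, with generators `X` and relations `R`; see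
`presentedAlgebra_universal`. -/
def presentedAlgebra {X : Type u} (R : FreeAlgebra ℂ X → FreeAlgebra ℂ X → Prop) :
    NonUnitalSubalgebra ℂ (RingQuot R) :=
  NonUnitalAlgebra.adjoin ℂ
    (Set.range fun x => RingQuot.mkAlgHom ℂ R (FreeAlgebra.ι ℂ x))

instance {X : Type u} (R : FreeAlgebra ℂ X → FreeAlgebra ℂ X → Prop) :
    NonUnitalRing (presentedAlgebra R) :=
  NonUnitalSubalgebra.toNonUnitalRing (presentedAlgebra R)

instance {X : Type u} (R : FreeAlgebra ℂ X → FreeAlgebra ℂ X → Prop) :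
    Module ℂ (presentedAlgebra R) :=
  (presentedAlgebra R).instModule

/-- The generators. -/
def presentedAlgebra.gen {X : Type u} (R : FreeAlgebra ℂ X → FreeAlgebra ℂ X → Prop) (x : X) :
    presentedAlgebra R :=
  ⟨RingQuot.mkAlgHom ℂ R (FreeAlgebra.ι ℂ x), NonUnitalAlgebra.subset_adjoin ℂ ⟨x, rfl⟩⟩

/-- The universal property: elements `t x` of a complex algebra `B` that satisfy the relations
(read in the unitization of `B`) are the images of the generators under a unique homomorphism. -/
theorem presentedAlgebra_universal {X : Type u} (R : FreeAlgebra ℂ X → FreeAlgebra ℂ X → Prop)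
    {B : Type w} [NonUnitalRing B] [Module ℂ B] [IsScalarTower ℂ B B] [SMulCommClass ℂ B B]
    (t : X → B)
    (ht : ∀ p q, R p q → FreeAlgebra.lift ℂ (fun x => (t x : Unitization ℂ B)) p =
      FreeAlgebra.lift ℂ (fun x => (t x : Unitization ℂ B)) q) :
    ∃! π : presentedAlgebra R →ₙₐ[ℂ] B, ∀ x, π (presentedAlgebra.gen R x) = t x := by
  let L : RingQuot R →ₐ[ℂ] Unitization ℂ B := RingQuot.liftAlgHom ℂ ⟨_, fun p q h => ht p q h⟩
  have hL : ∀ x, L (RingQuot.mkAlgHom ℂ R (FreeAlgebra.ι ℂ x)) = (t x : Unitization ℂ B) := by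
    intro x
    simp [L]
  have hfst : ∀ z : presentedAlgebra R, (L z).fst = 0 := by
    rintro ⟨z, hz⟩
    refine NonUnitalAlgebra.adjoin_induction (p := fun z _ => (L z).fst = 0) ?_ ?_ ?_ ?_ ?_ hz
    · rintro _ ⟨x, rfl⟩
      simp [hL]
    · intro a b _ _ ha hb
      simp [ha, hb]
    · simp
    · intro a b _ _ ha hb
      simp [ha, hb]
    · intro c a _ ha
      simp [ha]
  refine ⟨{ toFun := fun z => (L z).snd
            map_smul' := fun c z => by
              change (L (c • (z : RingQuot R))).snd = c • (L z).snd
              simp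
            map_zero' := by simp
            map_add' := fun a b => by simp
            map_mul' := fun a b => by simp [hfst] }, fun x => ?_, fun π hπ => ?_⟩
  · change (L (RingQuot.mkAlgHom ℂ R (FreeAlgebra.ι ℂ x))).snd = t x
    simp [hL]
  · ext ⟨z, hz⟩
    change π ⟨z, hz⟩ = (L z).snd
    refine NonUnitalAlgebra.adjoin_induction
      (p := fun z hz => π ⟨z, hz⟩ = (L z).snd) ?_ ?_ ?_ ?_ ?_ hz
    · rintro _ ⟨x, rfl⟩
      rw [hL]
      exact hπ x
    · intro a b ha hb h1 h2
      refine (map_add π ⟨a, ha⟩ ⟨b, hb⟩).trans ?_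
      rw [h1, h2]
      simp
    · refine (map_zero π).trans ?_
      simp
    · intro a b ha hb h1 h2
      refine (map_mul π ⟨a, ha⟩ ⟨b, hb⟩).trans ?_
      rw [h1, h2]
      have ha' := hfst ⟨a, ha⟩
      have hb' := hfst ⟨b, hb⟩
      simp only at ha' hb'
      simp [ha', hb']
    · intro c a ha h1
      refine (map_smul π c ⟨a, ha⟩).trans ?_
      rw [h1]
      simp

/-! ### Kumjian-Pask algebras -/

namespace KGraph

variable {k : ℕ} (Λ : KGraph.{u, v} k)

/-- The generators `p_v`, `s_λ` and `s_{λ*}` of the Kumjian-Pask algebra. -/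
inductive KPGen : Type (max u v)
  | vert : Λ.Vert → KPGen
  | real : Λ.Path → KPGen
  | ghost : Λ.Path → KPGen

open FreeAlgebra in
open scoped Classical in
/-- The Kumjian-Pask relations. As usual, `s_λ` and `s_{λ*}` mean `p_v` when `λ` is the identity
at the vertex `v`, so that the relations for paths of degree zero only repeat `idem` and
`orth`. -/
inductive KPRel : FreeAlgebra ℂ Λ.KPGen → FreeAlgebra ℂ Λ.KPGen → Prop
  | real_one (a) : KPRel (ι ℂ (.real (Λ.one a))) (ι ℂ (.vert a))
  | ghost_one (a) : KPRel (ι ℂ (.ghost (Λ.one a))) (ι ℂ (.vert a))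
  | idem (a) : KPRel (ι ℂ (.vert a) * ι ℂ (.vert a)) (ι ℂ (.vert a))
  | orth (a b) (h : a ≠ b) : KPRel (ι ℂ (.vert a) * ι ℂ (.vert b)) 0
  | real_mul (lam mu) (h : Λ.s lam = Λ.r mu) :
      KPRel (ι ℂ (.real lam) * ι ℂ (.real mu)) (ι ℂ (.real (Λ.comp lam mu h)))
  | ghost_mul (lam mu) (h : Λ.s lam = Λ.r mu) :
      KPRel (ι ℂ (.ghost mu) * ι ℂ (.ghost lam)) (ι ℂ (.ghost (Λ.comp lam mu h)))
  | r_real (lam) : KPRel (ι ℂ (.vert (Λ.r lam)) * ι ℂ (.real lam)) (ι ℂ (.real lam))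
  | real_s (lam) : KPRel (ι ℂ (.real lam) * ι ℂ (.vert (Λ.s lam))) (ι ℂ (.real lam))
  | s_ghost (lam) : KPRel (ι ℂ (.vert (Λ.s lam)) * ι ℂ (.ghost lam)) (ι ℂ (.ghost lam))
  | ghost_r (lam) : KPRel (ι ℂ (.ghost lam) * ι ℂ (.vert (Λ.r lam))) (ι ℂ (.ghost lam))
  | ghost_real (lam mu) (h : Λ.d lam = Λ.d mu) :
      KPRel (ι ℂ (.ghost lam) * ι ℂ (.real mu)) (if lam = mu then ι ℂ (.vert (Λ.s lam)) else 0)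
  | sum (a) (n : Fin k → ℕ) (F : Finset Λ.Path) (hF : (F : Set Λ.Path) = Λ.pathsFrom a n) :
      KPRel (ι ℂ (.vert a)) (∑ lam ∈ F, ι ℂ (.real lam) * ι ℂ (.ghost lam))

/-- The Kumjian-Pask algebra `KP(Λ, ℂ)`. -/
abbrev KumjianPask := presentedAlgebra Λ.KPRel

end KGraph

/-! ### Leavitt path algebras -/

/-- A directed graph, with range and source maps. -/
structure DirectedGraph where
  Vert : Type u
  Edge : Type v
  r : Edge → Vert
  s : Edge → Vert

namespace DirectedGraph

variable (E : DirectedGraph.{u, v})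

/-- The generators `v`, `e` and `e*` of the Leavitt path algebra. -/
inductive LPGen : Type (max u v)
  | vert : E.Vert → LPGen
  | real : E.Edge → LPGen
  | ghost : E.Edge → LPGen

open FreeAlgebra in
open scoped Classical in
/-- The relations of the Leavitt path algebra, in the convention in which a product `ef` of edges
is a path when `s(e) = r(f)`; so the second Cuntz-Krieger relation, `sum`, is imposed at
each vertex that receives a finite, non-zero number of edges. -/
inductive LPRel : FreeAlgebra ℂ E.LPGen → FreeAlgebra ℂ E.LPGen → Prop
  | idem (a) : LPRel (ι ℂ (.vert a) * ι ℂ (.vert a)) (ι ℂ (.vert a))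
  | orth (a b) (h : a ≠ b) : LPRel (ι ℂ (.vert a) * ι ℂ (.vert b)) 0
  | r_real (e) : LPRel (ι ℂ (.vert (E.r e)) * ι ℂ (.real e)) (ι ℂ (.real e))
  | real_s (e) : LPRel (ι ℂ (.real e) * ι ℂ (.vert (E.s e))) (ι ℂ (.real e))
  | s_ghost (e) : LPRel (ι ℂ (.vert (E.s e)) * ι ℂ (.ghost e)) (ι ℂ (.ghost e))
  | ghost_r (e) : LPRel (ι ℂ (.ghost e) * ι ℂ (.vert (E.r e))) (ι ℂ (.ghost e))
  | ghost_real (e f) :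
      LPRel (ι ℂ (.ghost e) * ι ℂ (.real f)) (if e = f then ι ℂ (.vert (E.s e)) else 0)
  | sum (a) (F : Finset E.Edge) (hF : (F : Set E.Edge) = {e | E.r e = a}) (hne : F.Nonempty) :
      LPRel (ι ℂ (.vert a)) (∑ e ∈ F, ι ℂ (.real e) * ι ℂ (.ghost e))

/-- The Leavitt path algebra `L_ℂ(E)`. -/
abbrev LeavittPath := presentedAlgebra E.LPRel

end DirectedGraph

/-- The directed graph `E = (Λ⁰, Λ¹, r, s)` of a `1`-graph `Λ`. -/
def KGraph.graph (Λ : KGraph.{u, v} 1) : DirectedGraph.{u, v} where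
  Vert := Λ.Vert
  Edge := {lam : Λ.Path // Λ.d lam = 1}
  r e := Λ.r e
  s e := Λ.s e

/-!
The Kumjian-Pask algebra, and for `k = 1` the Leavitt path algebra, is compared with `A(G_Λ)` by
letting it act on the vector space with basis `Λ^∞ × ℤ^k`: the generator `s_a` maps `(x, n)` to
`(ax, n + d(a))`, and `s_{a*}` undoes this. The matrix coefficient of an operator `T` from `(y, 0)`
to `(x, n)` defines a function `coeff T` on the path groupoid. The operator of `s_a s_{b*}` has the
indicator function of `Z(a, b)` as its coefficient function (`coeff_realOp_mul_ghostOp`). All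
operators in question are invariant under translation of the `ℤ^k`-component and have coefficients
supported on the groupoid, so the product of matrices turns into convolution (`coeff_mul`). Thus no
ring structure on `A(G_Λ)` has to be constructed beforehand.

The relations show that the algebra is spanned by the elements `s_a s_{b*}` (`KPFamily.mul_mem`),
and inserting `p_v = ∑ s_c s_{c*}` rewrites any element as a combination of such elements whose
first path `a` has one common degree `n` (`KPFamily.exists_mem_spanDeg`). For fixed `n` the
cylinders `Z(a, b)` with `d(a) = n` are pairwise disjoint (`eq_of_mem_cylinder`), and they are
non-empty since `Λ` has no sources (`cylinder_nonempty`), so their indicator functions are linearly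
independent and the map to `A(G_Λ)` is injective. For surjectivity, the support of a compactly
supported locally constant function is covered by finitely many cylinders with a common degree
`d(a) = n` on which the function is constant (`mem_span_indicator_cylinder`). That indicator
functions of cylinders belong to `A(G_Λ)` rests on row-finiteness, which makes cylinders compact
(`isCompact_cylinder`).

The argument only uses a Kumjian-Pask family that spans the algebra and is represented on the path
space (`exists_algebraIso`). In the Leavitt path algebra of a `1`-graph such a family is obtained by
multiplying the generators along the edges of a path (`EdgeFamily.toKPFamily`).
-/

namespace KGraph

variable {k : ℕ} (Λ : KGraph.{u, v} k)

/-! ### Factorisation of paths -/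

open scoped Classical in
/-- Composition as a total function, with the junk value `a` when `s a ≠ r b`. It carries no proof
argument, so that its arguments can be rewritten. -/
noncomputable def mul (a b : Λ.Path) : Λ.Path :=
  if h : Λ.s a = Λ.r b then Λ.comp a b h else a

variable {Λ} {a b c a' b' : Λ.Path} {m n p : Fin k → ℕ}

theorem mul_eq (h : Λ.s a = Λ.r b) : Λ.mul a b = Λ.comp a b h := dif_pos h

theorem r_mul (a b : Λ.Path) : Λ.r (Λ.mul a b) = Λ.r a := by
  unfold mul; split_ifs with h
  · exact Λ.r_comp _ _ _
  · rfl

theorem s_mul (h : Λ.s a = Λ.r b) : Λ.s (Λ.mul a b) = Λ.s b := by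
  rw [mul_eq h, Λ.s_comp]

theorem d_mul (h : Λ.s a = Λ.r b) : Λ.d (Λ.mul a b) = Λ.d a + Λ.d b := by
  rw [mul_eq h, Λ.d_comp]

theorem mul_assoc (h : Λ.s a = Λ.r b) (h' : Λ.s b = Λ.r c) :
    Λ.mul (Λ.mul a b) c = Λ.mul a (Λ.mul b c) := by
  have e : Λ.s a = Λ.r (Λ.mul b c) := h.trans (r_mul b c).symm
  have e' : Λ.s (Λ.mul a b) = Λ.r c := (s_mul h).trans h'
  rw [mul_eq e, mul_eq e']
  simp only [mul_eq h, mul_eq h']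
  exact Λ.assoc a b c h h'

theorem one_mul (a : Λ.Path) : Λ.mul (Λ.one (Λ.r a)) a = a := by
  rw [mul_eq (Λ.s_one _), Λ.one_comp]

theorem mul_one (a : Λ.Path) : Λ.mul a (Λ.one (Λ.s a)) = a := by
  rw [mul_eq (Λ.r_one _).symm, Λ.comp_one]

theorem exists_mul_eq (h : n ≤ Λ.d a) :
    ∃ b c, Λ.s b = Λ.r c ∧ Λ.d b = n ∧ Λ.mul b c = a := by
  obtain ⟨⟨b, c⟩, ⟨e, h1, -, h3⟩, -⟩ :=
    Λ.factorisation a n (Λ.d a - n) (add_tsub_cancel_of_le h).symm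
  exact ⟨b, c, e, h1, (mul_eq e).trans h3⟩

theorem mul_inj (h : Λ.s a = Λ.r b) (h' : Λ.s a' = Λ.r b') (hd : Λ.d a = Λ.d a')
    (e : Λ.mul a b = Λ.mul a' b') : a = a' ∧ b = b' := by
  have hd2 : Λ.d b' = Λ.d b := by
    have := congrArg Λ.d e
    rw [d_mul h, d_mul h', hd] at this
    exact (add_left_cancel this).symm
  have := (Λ.factorisation (Λ.mul a b) (Λ.d a) (Λ.d b) (d_mul h)).unique
    (y₁ := (a, b)) (y₂ := (a', b')) ⟨h, rfl, rfl, (mul_eq h).symm⟩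
    ⟨h', hd.symm, hd2, (mul_eq h').symm.trans e.symm⟩
  exact Prod.ext_iff.1 this

theorem eq_one_of_d_eq_zero (h : Λ.d a = 0) : a = Λ.one (Λ.r a) :=
  (mul_inj (a := a) (b := Λ.one (Λ.s a)) (a' := Λ.one (Λ.r a)) (b' := a) (Λ.r_one _).symm
    (Λ.s_one _) (h.trans (Λ.d_one _).symm) ((mul_one a).trans (one_mul a).symm)).1

variable (Λ) in
open scoped Classical in
/-- The initial segment `a(0, n)` of a path `a`; junk unless `n ≤ d a`. -/
noncomputable def pre (n : Fin k → ℕ) (a : Λ.Path) : Λ.Path :=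
  if h : n ≤ Λ.d a then (exists_mul_eq h).choose else a

variable (Λ) in
open scoped Classical in
/-- The final segment `a(n, d a)` of a path `a`; junk unless `n ≤ d a`. -/
noncomputable def suf (n : Fin k → ℕ) (a : Λ.Path) : Λ.Path :=
  if h : n ≤ Λ.d a then (exists_mul_eq h).choose_spec.choose else a

theorem pre_suf_spec (h : n ≤ Λ.d a) : Λ.s (Λ.pre n a) = Λ.r (Λ.suf n a) ∧
    Λ.d (Λ.pre n a) = n ∧ Λ.mul (Λ.pre n a) (Λ.suf n a) = a := by
  simp only [pre, suf, dif_pos h]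
  exact (exists_mul_eq h).choose_spec.choose_spec

theorem s_pre (h : n ≤ Λ.d a) : Λ.s (Λ.pre n a) = Λ.r (Λ.suf n a) := (pre_suf_spec h).1

theorem d_pre (h : n ≤ Λ.d a) : Λ.d (Λ.pre n a) = n := (pre_suf_spec h).2.1

theorem pre_mul_suf (h : n ≤ Λ.d a) : Λ.mul (Λ.pre n a) (Λ.suf n a) = a := (pre_suf_spec h).2.2

theorem r_pre (h : n ≤ Λ.d a) : Λ.r (Λ.pre n a) = Λ.r a := by
  conv_rhs => rw [← pre_mul_suf h, r_mul]

theorem s_suf (h : n ≤ Λ.d a) : Λ.s (Λ.suf n a) = Λ.s a := by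
  conv_rhs => rw [← pre_mul_suf h, s_mul (s_pre h)]

theorem add_d_suf (h : n ≤ Λ.d a) : n + Λ.d (Λ.suf n a) = Λ.d a := by
  conv_rhs => rw [← pre_mul_suf h, d_mul (s_pre h), d_pre h]

theorem pre_suf_mul (h : Λ.s a = Λ.r b) (hd : Λ.d a = n) :
    Λ.pre n (Λ.mul a b) = a ∧ Λ.suf n (Λ.mul a b) = b := by
  have hn : n ≤ Λ.d (Λ.mul a b) := by rw [d_mul h, hd]; exact le_self_add
  exact mul_inj (s_pre hn) h ((d_pre hn).trans hd.symm) (pre_mul_suf hn)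

theorem pre_mul (h : Λ.s a = Λ.r b) (hd : Λ.d a = n) : Λ.pre n (Λ.mul a b) = a :=
  (pre_suf_mul h hd).1

theorem suf_mul (h : Λ.s a = Λ.r b) (hd : Λ.d a = n) : Λ.suf n (Λ.mul a b) = b :=
  (pre_suf_mul h hd).2

/-- The initial segment of an initial segment. -/
theorem pre_pre (hmn : m ≤ n) (h : n ≤ Λ.d a) : Λ.pre m (Λ.pre n a) = Λ.pre m a := by
  have h1 : m ≤ Λ.d (Λ.pre n a) := hmn.trans (d_pre h).ge
  have e1 : Λ.s (Λ.suf m (Λ.pre n a)) = Λ.r (Λ.suf n a) := by rw [s_suf h1, s_pre h]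
  have e : a = Λ.mul (Λ.pre m (Λ.pre n a)) (Λ.mul (Λ.suf m (Λ.pre n a)) (Λ.suf n a)) := by
    rw [← mul_assoc (s_pre h1) e1, pre_mul_suf h1, pre_mul_suf h]
  conv_rhs => rw [e]
  exact (pre_mul (by rw [r_mul, s_pre h1]) (d_pre h1)).symm

theorem pre_of_mul (h : Λ.s a = Λ.r b) (hn : n ≤ Λ.d a) : Λ.pre n (Λ.mul a b) = Λ.pre n a := by
  have h2 : Λ.d a ≤ Λ.d (Λ.mul a b) := by rw [d_mul h]; exact le_self_add
  rw [← pre_pre hn h2, pre_mul h rfl]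

/-! ### Infinite paths -/

namespace InfPath

variable {x y z : Λ.InfPath}

theorem map_congr (x : Λ.InfPath) {m n m' n' : Fin k → ℕ} (hm : m = m') (hn : n = n')
    (h : m ≤ n) (h' : m' ≤ n') : x.map m n h = x.map m' n' h' := by
  subst hm hn; rfl

theorem r_seg (x : Λ.InfPath) (n) : Λ.r (x.seg n) = x.obj 0 := x.r_map _ _ _

theorem s_seg (x : Λ.InfPath) (n) : Λ.s (x.seg n) = x.obj n := x.s_map _ _ _

theorem d_seg (x : Λ.InfPath) (n) : Λ.d (x.seg n) = n := by
  have := x.d_map 0 n (fun _ => Nat.zero_le _)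
  rwa [zero_add] at this

theorem seg_zero (x : Λ.InfPath) : x.seg 0 = Λ.one (x.obj 0) := x.map_self 0

theorem shift_zero (x : Λ.InfPath) : x.shift 0 = x := by
  ext <;> simp [shift]

theorem obj_shift (x : Λ.InfPath) (p) : (x.shift p).obj 0 = x.obj p := by
  simp [shift]

theorem seg_mul_map (x : Λ.InfPath) (h : m ≤ n) : Λ.mul (x.seg m) (x.map m n h) = x.seg n := by
  rw [mul_eq ((x.s_seg m).trans (x.r_map _ _ _).symm)]
  exact x.map_comp 0 m n _ h

theorem seg_mul_seg_shift (x : Λ.InfPath) (p n) :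
    Λ.mul (x.seg p) ((x.shift p).seg n) = x.seg (p + n) := by
  rw [← x.seg_mul_map (le_self_add : p ≤ p + n)]
  congr 1
  exact x.map_congr (zero_add p) (add_comm n p) _ _

theorem s_seg_eq_r_seg_shift (x : Λ.InfPath) (p n) :
    Λ.s (x.seg p) = Λ.r ((x.shift p).seg n) := by
  rw [s_seg, r_seg, obj_shift]

theorem seg_eq_pre (x : Λ.InfPath) (h : m ≤ n) : x.seg m = Λ.pre m (x.seg n) := by
  rw [← x.seg_mul_map h, pre_mul ((x.s_seg m).trans (x.r_map _ _ _).symm) (x.d_seg m)]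

theorem seg_eq_of_le (hmn : m ≤ n) (h : x.seg n = y.seg n) : x.seg m = y.seg m := by
  rw [x.seg_eq_pre hmn, y.seg_eq_pre hmn, h]

theorem ext_seg (h : ∀ n, x.seg n = y.seg n) : x = y := by
  refine InfPath.ext ?_ ?_
  · funext n
    rw [← s_seg, ← s_seg, h]
  · funext m n hmn
    refine (mul_inj ((x.s_seg m).trans (x.r_map _ _ _).symm)
      ((y.s_seg m).trans (y.r_map _ _ _).symm) (by rw [h]) ?_).2
    rw [seg_mul_map, seg_mul_map, h]

theorem eq_of_seg_of_shift (h : x.seg p = y.seg p) (h' : x.shift p = y.shift p) : x = y :=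
  ext_seg fun n => seg_eq_of_le (le_add_self : n ≤ p + n) (by
    rw [← seg_mul_seg_shift, ← seg_mul_seg_shift, h, h'])

theorem seg_shift_eq_iff (e : x.seg p = a) (h : Λ.s a = Λ.r b) :
    x.seg (p + n) = Λ.mul a b ↔ (x.shift p).seg n = b := by
  subst e
  rw [← seg_mul_seg_shift]
  refine ⟨fun h' => (mul_inj (s_seg_eq_r_seg_shift _ _ _) h rfl h').2, fun h' => by rw [h']⟩

theorem seg_add_eq_mul_iff (h : Λ.s a = Λ.r b) :
    x.seg (Λ.d a + Λ.d b) = Λ.mul a b ↔ x.seg (Λ.d a) = a ∧ (x.shift (Λ.d a)).seg (Λ.d b) = b := by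
  constructor
  · intro h'
    have : x.seg (Λ.d a) = a := by
      rw [x.seg_eq_pre (le_self_add : Λ.d a ≤ Λ.d a + Λ.d b), h', pre_mul h rfl]
    exact ⟨this, (seg_shift_eq_iff this h).1 h'⟩
  · rintro ⟨h1, h2⟩
    exact (seg_shift_eq_iff h1 h).2 h2

/-- A coherent family of paths, one of each degree, is the family of initial segments of an
infinite path. -/
theorem exists_seg_eq (f : (Fin k → ℕ) → Λ.Path) (hd : ∀ n, Λ.d (f n) = n)
    (hf : ∀ m n, m ≤ n → Λ.pre m (f n) = f m) : ∃ x : Λ.InfPath, ∀ n, x.seg n = f n := by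
  have hle : ∀ {m n}, m ≤ n → m ≤ Λ.d (f n) := fun {m n} h => h.trans (hd n).ge
  have hr : ∀ m n, m ≤ n → Λ.s (f m) = Λ.r (Λ.suf m (f n)) := fun m n h => by
    rw [← hf m n h, s_pre (hle h)]
  have hmul : ∀ m n, m ≤ n → Λ.mul (f m) (Λ.suf m (f n)) = f n := fun m n h => by
    conv_lhs => rw [← hf m n h]
    exact pre_mul_suf (hle h)
  refine ⟨{ obj := fun n => Λ.s (f n)
            map := fun m n _ => Λ.suf m (f n)
            r_map := fun m n h => (hr m n h).symm
            s_map := fun m n h => s_suf (hle h)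
            map_self := fun m => ?_
            map_comp := fun l m n h h' => ?_
            d_map := fun m n h => (add_d_suf (hle h)).trans (hd n) }, fun n => ?_⟩
  · exact (mul_inj (hr m m le_rfl) (Λ.r_one _).symm rfl
      ((hmul m m le_rfl).trans (mul_one _).symm)).2
  · have e : Λ.s (Λ.suf l (f m)) = Λ.r (Λ.suf m (f n)) := by rw [s_suf (hle h), hr m n h']
    rw [← mul_eq e]
    refine (mul_inj (a := f l) (a' := f l) ?_ (hr l n (h.trans h')) rfl ?_).2
    · rw [r_mul, hr l m h]
    · rw [← mul_assoc (hr l m h) e, hmul l m h, hmul m n h', hmul l n (h.trans h')]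
  · have h0 : (0 : Fin k → ℕ) ≤ n := fun _ => Nat.zero_le _
    change Λ.suf 0 (f n) = f n
    have h1 : f 0 = Λ.one (Λ.r (f n)) := by
      rw [eq_one_of_d_eq_zero (hd 0), ← hf 0 n h0, r_pre (hle h0)]
    refine (mul_inj (a := f 0) (a' := f 0) (hr 0 n h0) (by rw [h1, Λ.s_one]) rfl ?_).2
    rw [hmul 0 n h0, h1, one_mul]

/-- An increasing cofinal family of paths determines an infinite path. -/
theorem exists_seg_eq_pre (F : (Fin k → ℕ) → Λ.Path) (hd : ∀ n, n ≤ Λ.d (F n))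
    (hF : ∀ m n, m ≤ n → ∃ b, Λ.s (F m) = Λ.r b ∧ Λ.mul (F m) b = F n) :
    ∃ x : Λ.InfPath, ∀ n, x.seg n = Λ.pre n (F n) := by
  refine exists_seg_eq _ (fun n => d_pre (hd n)) fun m n h => ?_
  obtain ⟨b, hb, e⟩ := hF m n h
  rw [pre_pre h (hd n), ← e, pre_of_mul hb (hd m)]

/-- The initial segments of the infinite path `az` are those of the paths `a z(0, n)`. -/
theorem exists_mul (a : Λ.Path) (z : Λ.InfPath) (h : Λ.s a = z.obj 0) :
    ∃ x : Λ.InfPath, x.seg (Λ.d a) = a ∧ x.shift (Λ.d a) = z := by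
  have hz : ∀ n, Λ.s a = Λ.r (z.seg n) := fun n => h.trans (z.r_seg n).symm
  obtain ⟨x, hx⟩ := exists_seg_eq_pre (fun n => Λ.mul a (z.seg n))
    (fun n => by rw [d_mul (hz n), d_seg]; exact le_add_self)
    (fun m n hmn => ⟨z.map m n hmn, by rw [s_mul (hz m), s_seg, r_map], by
      rw [mul_assoc (hz m) (by rw [s_seg, r_map]), seg_mul_map]⟩)
  have h1 : x.seg (Λ.d a) = a := by rw [hx, pre_mul (hz _) rfl]
  refine ⟨x, h1, ext_seg fun n => (seg_shift_eq_iff h1 (hz n)).1 ?_⟩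
  rw [hx]
  have hn : n ≤ Λ.d a + n := le_add_self
  have e1 : Λ.s (z.seg n) = Λ.r (z.map n _ hn) := by rw [s_seg, r_map]
  rw [← z.seg_mul_map hn, ← mul_assoc (hz n) e1,
    pre_mul (by rw [s_mul (hz n), e1]) (by rw [d_mul (hz n), d_seg])]

open scoped Classical in
/-- The infinite path `az`, with the junk value `z` when `s a ≠ r z`. -/
noncomputable def cons (a : Λ.Path) (z : Λ.InfPath) : Λ.InfPath :=
  if h : Λ.s a = z.obj 0 then (exists_mul a z h).choose else z

theorem seg_cons (h : Λ.s a = z.obj 0) : (cons a z).seg (Λ.d a) = a := by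
  rw [cons, dif_pos h]; exact (exists_mul a z h).choose_spec.1

theorem shift_cons (h : Λ.s a = z.obj 0) : (cons a z).shift (Λ.d a) = z := by
  rw [cons, dif_pos h]; exact (exists_mul a z h).choose_spec.2

theorem s_of_seg_eq (h : x.seg (Λ.d a) = a) : Λ.s a = (x.shift (Λ.d a)).obj 0 := by
  conv_lhs => rw [← h, s_seg]
  rw [obj_shift]

theorem cons_eq_iff (h : Λ.s a = z.obj 0) :
    cons a z = x ↔ x.seg (Λ.d a) = a ∧ x.shift (Λ.d a) = z := by
  constructor
  · rintro rfl
    exact ⟨seg_cons h, shift_cons h⟩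
  · rintro ⟨h1, h2⟩
    exact eq_of_seg_of_shift ((seg_cons h).trans h1.symm) ((shift_cons h).trans h2.symm)

theorem cons_shift (h : x.seg (Λ.d a) = a) : cons a (x.shift (Λ.d a)) = x :=
  (cons_eq_iff (s_of_seg_eq h)).2 ⟨h, rfl⟩

theorem obj_cons (h : Λ.s a = z.obj 0) : (cons a z).obj 0 = Λ.r a := by
  rw [← r_seg _ (Λ.d a), seg_cons h]

theorem cons_one (h : Λ.s (Λ.one (z.obj 0)) = z.obj 0) : cons (Λ.one (z.obj 0)) z = z := by
  rw [cons_eq_iff h, Λ.d_one, shift_zero, seg_zero]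
  exact ⟨rfl, rfl⟩

theorem cons_cons (h : Λ.s a = Λ.r b) (h' : Λ.s b = z.obj 0) :
    cons a (cons b z) = cons (Λ.mul a b) z := by
  refine ((cons_eq_iff ((s_mul h).trans h')).2 ?_).symm
  have h1 : Λ.s a = (cons b z).obj 0 := by rw [obj_cons h', h]
  rw [d_mul h, seg_add_eq_mul_iff h, add_comm, ← shift_shift, shift_cons h1, seg_cons h1,
    shift_cons h', seg_cons h']
  exact ⟨⟨rfl, rfl⟩, rfl⟩

/-- Multiplying paths of degree `(1, …, 1)` gives paths `G j` of degree `(j, …, j)`, and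
`G (∑ i, n i)` has degree at least `n`. -/
theorem exists_obj_zero_eq (hns : Λ.NoSources) (v : Λ.Vert) : ∃ x : Λ.InfPath, x.obj 0 = v := by
  choose e he using fun w => hns w 1
  have her : ∀ w, Λ.r (e w) = w := fun w => (he w).1
  have hed : ∀ w, Λ.d (e w) = 1 := fun w => (he w).2
  let G : ℕ → Λ.Path := fun j => Nat.rec (Λ.one v) (fun _ a => Λ.mul a (e (Λ.s a))) j
  have hG : ∀ j, G (j + 1) = Λ.mul (G j) (e (Λ.s (G j))) := fun j => rfl
  have hGd : ∀ j, Λ.d (G j) = fun _ => j := by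
    intro j
    induction j with
    | zero => exact Λ.d_one v
    | succ j ih => rw [hG, d_mul (her _).symm, hed, ih]; rfl
  have hGr : ∀ j, Λ.r (G j) = v := by
    intro j
    induction j with
    | zero => exact Λ.r_one v
    | succ j ih => rw [hG, r_mul, ih]
  have hGp : ∀ i j, i ≤ j → ∃ b, Λ.s (G i) = Λ.r b ∧ Λ.mul (G i) b = G j := by
    intro i j hij
    induction j, hij using Nat.le_induction with
    | base => exact ⟨Λ.one (Λ.s (G i)), (Λ.r_one _).symm, mul_one _⟩
    | succ j _ ih =>
      obtain ⟨b, hb, hb'⟩ := ih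
      have hs : Λ.s b = Λ.s (G j) := by rw [← hb', s_mul hb]
      refine ⟨Λ.mul b (e (Λ.s (G j))), by rw [r_mul, hb], ?_⟩
      rw [← mul_assoc hb (by rw [her, hs]), hb', hG]
  have hle : ∀ n : Fin k → ℕ, n ≤ Λ.d (G (∑ i, n i)) := fun n i => by
    rw [hGd]; exact Finset.single_le_sum (fun _ _ => Nat.zero_le _) (Finset.mem_univ i)
  obtain ⟨x, hx⟩ := exists_seg_eq_pre (fun n => G (∑ i, n i)) hle
    (fun m n h => hGp _ _ (Finset.sum_le_sum fun i _ => h i))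
  refine ⟨x, ?_⟩
  rw [← x.r_seg 0, hx, r_pre (hle 0), hGr]

end InfPath

/-! ### The topology of the path groupoid -/

section Topology

open Topology InfPath

variable {k : ℕ} {Λ : KGraph.{u, v} k} {a b c a' b' : Λ.Path} {g g' : Λ.PathGroupoid}

theorem s_eq_of_mem_cylinder (h : g ∈ cylinder a b) : Λ.s a = Λ.s b := by
  obtain ⟨h1, h2, h3, -⟩ := h
  rw [s_of_seg_eq h1, s_of_seg_eq h2, h3]

/-- `Z(ac, bc)` consists of the elements `(az, d(a) - d(b), bz)` of `Z(a, b)` such that `z` begins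
with `c`. -/
theorem mem_cylinder_mul_iff (ha : Λ.s a = Λ.r c) (hb : Λ.s b = Λ.r c) :
    g ∈ cylinder (Λ.mul a c) (Λ.mul b c) ↔
      g ∈ cylinder a b ∧ (g.rng.shift (Λ.d a)).seg (Λ.d c) = c := by
  simp only [cylinder, Set.mem_ofPred_eq, d_mul ha, d_mul hb, seg_add_eq_mul_iff ha,
    seg_add_eq_mul_iff hb, Pi.add_apply]
  constructor
  · rintro ⟨⟨h1, h2⟩, ⟨h3, h4⟩, h5, h6⟩
    refine ⟨⟨h1, h3, ?_, fun i => by rw [h6]; push_cast; ring⟩, h2⟩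
    rw [add_comm, ← shift_shift, add_comm, ← shift_shift] at h5
    exact eq_of_seg_of_shift (h2.trans h4.symm) h5
  · rintro ⟨⟨h1, h2, h3, h4⟩, h5⟩
    refine ⟨⟨h1, h5⟩, ⟨h2, h3 ▸ h5⟩, ?_, fun i => by rw [h4]; push_cast; ring⟩
    rw [add_comm, ← shift_shift, h3, shift_shift, add_comm]

theorem exists_mem_cylinder_mul (h : g ∈ cylinder a b) (n : Fin k → ℕ) :
    ∃ c, Λ.s a = Λ.r c ∧ Λ.s b = Λ.r c ∧ Λ.d c = n ∧ g ∈ cylinder (Λ.mul a c) (Λ.mul b c) := by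
  have ha : Λ.s a = Λ.r ((g.rng.shift (Λ.d a)).seg n) := by rw [s_of_seg_eq h.1, r_seg]
  have hb := (s_eq_of_mem_cylinder h).symm.trans ha
  refine ⟨_, ha, hb, d_seg _ n, (mem_cylinder_mul_iff ha hb).2 ⟨h, ?_⟩⟩
  rw [d_seg]

theorem eq_of_mem_cylinder (h : g ∈ cylinder a b) (h' : g ∈ cylinder a' b')
    (hd : Λ.d a = Λ.d a') : a = a' ∧ b = b' := by
  have hd' : Λ.d b = Λ.d b' := by
    funext i
    have h1 := h.2.2.2 i
    have h2 := h'.2.2.2 i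
    have h3 := congrFun hd i
    omega
  exact ⟨by rw [← h.1, ← h'.1, hd], by rw [← h.2.1, ← h'.2.1, hd']⟩

/-- Two cylinders are nested or disjoint as soon as their first degrees are comparable. -/
theorem cylinder_subset_of_mem (h : g ∈ cylinder a b) (h' : g ∈ cylinder a' b')
    (hd : Λ.d a' ≤ Λ.d a) : cylinder a b ⊆ cylinder a' b' := by
  obtain ⟨c, h1, h2, h3, h4⟩ := exists_mem_cylinder_mul h' (Λ.d a - Λ.d a')
  obtain ⟨rfl, rfl⟩ := eq_of_mem_cylinder h h4 (by rw [d_mul h1, h3, add_tsub_cancel_of_le hd])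
  exact fun x hx => ((mem_cylinder_mul_iff h1 h2).1 hx).1

theorem exists_mem_cylinder (g : Λ.PathGroupoid) (n : Fin k → ℕ) :
    ∃ a b, g ∈ cylinder a b ∧ n ≤ Λ.d a := by
  obtain ⟨l, m, h1, h2⟩ := g.tail
  have h : g ∈ cylinder (g.rng.seg l) (g.src.seg m) := by
    refine ⟨?_, ?_, ?_, ?_⟩ <;> simp only [d_seg, h1]
    exact h2
  obtain ⟨c, ha, -, hc, h'⟩ := exists_mem_cylinder_mul h n
  exact ⟨_, _, h', by rw [d_mul ha, hc]; exact le_add_self⟩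

theorem cylinder_nonempty (hns : Λ.NoSources) (h : Λ.s a = Λ.s b) :
    (cylinder a b).Nonempty := by
  obtain ⟨z, hz⟩ := exists_obj_zero_eq hns (Λ.s a)
  have ha := hz.symm
  have hb := h.symm.trans ha
  have e : (cons a z).shift (Λ.d a) = (cons b z).shift (Λ.d b) := by
    rw [shift_cons ha, shift_cons hb]
  exact ⟨⟨cons a z, fun i => (Λ.d a i : ℤ) - Λ.d b i, cons b z, Λ.d a, Λ.d b, e, fun _ => rfl⟩,
    seg_cons ha, seg_cons hb, e, fun _ => rfl⟩

variable (Λ) in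
theorem isTopologicalBasis_cylinder : TopologicalSpace.IsTopologicalBasis
    {Z : Set Λ.PathGroupoid | ∃ a b, Λ.s a = Λ.s b ∧ Z = cylinder a b} where
  exists_subset_inter := by
    rintro _ ⟨a, b, hab, rfl⟩ _ ⟨a', b', hab', rfl⟩ g ⟨h, h'⟩
    obtain ⟨α, β, hg, hd⟩ := exists_mem_cylinder g (Λ.d a ⊔ Λ.d a')
    exact ⟨_, ⟨α, β, s_eq_of_mem_cylinder hg, rfl⟩, hg, Set.subset_inter
      (cylinder_subset_of_mem hg h (le_sup_left.trans hd))
      (cylinder_subset_of_mem hg h' (le_sup_right.trans hd))⟩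
  sUnion_eq := by
    refine Set.eq_univ_of_forall fun g => ?_
    obtain ⟨a, b, h, -⟩ := exists_mem_cylinder g 0
    exact ⟨_, ⟨a, b, s_eq_of_mem_cylinder h, rfl⟩, h⟩
  eq_generateFrom := rfl

theorem isOpen_cylinder (h : Λ.s a = Λ.s b) : IsOpen (cylinder a b) :=
  (isTopologicalBasis_cylinder Λ).isOpen ⟨a, b, h, rfl⟩

/-- A point outside `Z(a, b)` has a cylinder neighbourhood of larger degree, which is disjoint from
`Z(a, b)` because otherwise it would be contained in it. -/
theorem isClosed_cylinder : IsClosed (cylinder a b) := by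
  refine isOpen_compl_iff.1 (isOpen_iff_forall_mem_open.2 fun g hg => ?_)
  obtain ⟨α, β, h, hd⟩ := exists_mem_cylinder g (Λ.d a)
  exact ⟨cylinder α β, fun g' hg' hab => hg (cylinder_subset_of_mem hg' hab hd h),
    isOpen_cylinder (s_eq_of_mem_cylinder h), h⟩

/-- An ultrafilter on `Z(a, b)` contains exactly one of the finitely many sets `Z(ac, bc)` with
`d c = n`, for every `n`; these paths `c` are the initial segments of an infinite path `z`, and the
ultrafilter converges to `(az, d(a) - d(b), bz)`. -/
theorem isCompact_cylinder (hrf : Λ.RowFinite) (h : Λ.s a = Λ.s b) :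
    IsCompact (cylinder a b) := by
  refine isCompact_iff_ultrafilter_le_nhds'.2 fun U hU => ?_
  have key : ∀ n, ∃ c, Λ.r c = Λ.s a ∧ Λ.d c = n ∧ cylinder (Λ.mul a c) (Λ.mul b c) ∈ U := by
    intro n
    have hsub : cylinder a b ⊆
        ⋃ c ∈ Λ.pathsFrom (Λ.s a) n, cylinder (Λ.mul a c) (Λ.mul b c) := by
      intro g hg
      obtain ⟨c, ha, -, hc, hg'⟩ := exists_mem_cylinder_mul hg n
      exact Set.mem_biUnion (show c ∈ Λ.pathsFrom (Λ.s a) n from ⟨ha.symm, hc⟩) hg'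
    obtain ⟨c, ⟨h1, h2⟩, h3⟩ :=
      (Ultrafilter.finite_biUnion_mem_iff (hrf _ _)).1 (Filter.mem_of_superset hU hsub)
    exact ⟨c, h1, h2, h3⟩
  choose c hr hd hc using key
  have ha : ∀ n, Λ.s a = Λ.r (c n) := fun n => (hr n).symm
  have hb : ∀ n, Λ.s b = Λ.r (c n) := fun n => h.symm.trans (ha n)
  obtain ⟨z, hz⟩ := exists_seg_eq c hd (by
    intro m n hmn
    obtain ⟨g, hm, hn⟩ := U.nonempty_of_mem (Filter.inter_mem (hc m) (hc n))
    have em := ((mem_cylinder_mul_iff (ha m) (hb m)).1 hm).2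
    have en := ((mem_cylinder_mul_iff (ha n) (hb n)).1 hn).2
    rw [hd] at em en
    rw [← en, ← seg_eq_pre _ hmn, em])
  have hza : Λ.s a = z.obj 0 := by rw [← z.r_seg 0, hz, ← ha]
  have hzb : Λ.s b = z.obj 0 := h.symm.trans hza
  have e : (cons a z).shift (Λ.d a) = (cons b z).shift (Λ.d b) := by
    rw [shift_cons hza, shift_cons hzb]
  let g : Λ.PathGroupoid := ⟨cons a z, fun i => (Λ.d a i : ℤ) - Λ.d b i, cons b z,
    Λ.d a, Λ.d b, e, fun _ => rfl⟩
  have hg : g ∈ cylinder a b := ⟨seg_cons hza, seg_cons hzb, e, fun _ => rfl⟩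
  refine ⟨g, hg, fun V hV => ?_⟩
  obtain ⟨_, ⟨α, β, -, rfl⟩, hgα, hV'⟩ := (isTopologicalBasis_cylinder Λ).mem_nhds_iff.1 hV
  have hgn : g ∈ cylinder (Λ.mul a (c (Λ.d α))) (Λ.mul b (c (Λ.d α))) :=
    (mem_cylinder_mul_iff (ha _) (hb _)).2 ⟨hg, by
      change ((cons a z).shift (Λ.d a)).seg _ = _
      rw [shift_cons hza, hd, hz]⟩
  refine Filter.mem_of_superset (hc (Λ.d α)) ((cylinder_subset_of_mem hgn hgα ?_).trans hV')
  rw [d_mul (ha _), hd]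
  exact le_add_self

/-! ### Spanning `A(G_Λ)` by indicator functions of cylinders -/

theorem indicator_cylinder_mem (hrf : Λ.RowFinite) (h : Λ.s a = Λ.s b) :
    ((cylinder a b).indicator 1 : Λ.PathGroupoid → ℂ) ∈
      leavittGroupoidAlgebra Λ.PathGroupoid := by
  refine ⟨?_, ?_⟩
  · rw [IsLocallyConstant.iff_eventually_eq]
    intro g
    by_cases hg : g ∈ cylinder a b
    · filter_upwards [(isOpen_cylinder h).mem_nhds hg] with g' hg'
      rw [Set.indicator_of_mem hg, Set.indicator_of_mem hg']
      rfl
    · filter_upwards [isClosed_cylinder.isOpen_compl.mem_nhds hg] with g' hg'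
      rw [Set.indicator_of_notMem hg, Set.indicator_of_notMem hg']
  · refine HasCompactSupport.intro' (isCompact_cylinder hrf h) isClosed_cylinder fun g hg => ?_
    exact Set.indicator_of_notMem hg _

/-- The support of `f` is compact, so there is one degree `n` such that the support is covered by
finitely many cylinders `Z(a, b)` with `d a = n` on which `f` is constant. Cylinders of this kind
are pairwise disjoint. -/
theorem mem_span_indicator_cylinder {f : Λ.PathGroupoid → ℂ}
    (hf : f ∈ leavittGroupoidAlgebra Λ.PathGroupoid) :
    f ∈ Submodule.span ℂ {u : Λ.PathGroupoid → ℂ |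
      ∃ a b, Λ.s a = Λ.s b ∧ u = (cylinder a b).indicator 1} := by
  obtain ⟨hlc, hcs⟩ := hf
  -- The sets `U n` increase with `n`, so that compactness yields a single degree for the cover.
  let P : (Fin k → ℕ) → Set (Λ.Path × Λ.Path) := fun n =>
    {q | Λ.s q.1 = Λ.s q.2 ∧ Λ.d q.1 = n ∧ ∃ c, ∀ g ∈ cylinder q.1 q.2, f g = c}
  let U : (Fin k → ℕ) → Set Λ.PathGroupoid := fun n => ⋃ q ∈ P n, cylinder q.1 q.2
  have hUo : ∀ n, IsOpen (U n) := fun n =>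
    isOpen_biUnion fun q hq => isOpen_cylinder hq.1
  have hUmono : Monotone U := by
    intro m n hmn g hg
    obtain ⟨q, ⟨hq1, hq2, c, hc⟩, hgq⟩ := Set.mem_iUnion₂.1 hg
    obtain ⟨e, he1, he2, he3, hge⟩ := exists_mem_cylinder_mul hgq (n - m)
    refine Set.mem_iUnion₂.2 ⟨(Λ.mul q.1 e, Λ.mul q.2 e), ⟨?_, ?_, c, fun g' hg' => ?_⟩, hge⟩
    · exact (s_mul he1).trans (s_mul he2).symm
    · change Λ.d (Λ.mul q.1 e) = n
      rw [d_mul he1, hq2, he3, add_tsub_cancel_of_le hmn]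
    · exact hc g' ((mem_cylinder_mul_iff he1 he2).1 hg').1
  have hUcov : ∀ g, ∃ n, g ∈ U n := by
    intro g
    obtain ⟨_, ⟨a, b, hab, rfl⟩, hg, hsub⟩ := (isTopologicalBasis_cylinder Λ).mem_nhds_iff.1
      ((IsLocallyConstant.iff_eventually_eq f).1 hlc g)
    exact ⟨Λ.d a, Set.mem_iUnion₂.2 ⟨(a, b), ⟨hab, rfl, f g, fun g' hg' => hsub hg'⟩, hg⟩⟩
  obtain ⟨n, hn⟩ := hcs.isCompact.elim_directed_cover U hUo
    (fun g _ => Set.mem_iUnion.2 (hUcov g)) hUmono.directed_le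
  obtain ⟨F, hFP, hFfin, hF⟩ := hcs.isCompact.elim_finite_subcover_image
    (b := P n) (c := fun q => cylinder q.1 q.2) (fun q hq => isOpen_cylinder hq.1) hn
  have hval : ∀ q : Λ.Path × Λ.Path, ∃ c, q ∈ F → ∀ g ∈ cylinder q.1 q.2, f g = c := by
    intro q
    by_cases hq : q ∈ F
    · obtain ⟨c, hc⟩ := (hFP hq).2.2
      exact ⟨c, fun _ => hc⟩
    · exact ⟨0, fun h => absurd h hq⟩
  choose c hc using hval
  have hfeq : f = ∑ q ∈ hFfin.toFinset,
      c q • ((cylinder q.1 q.2).indicator 1 : Λ.PathGroupoid → ℂ) := by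
    funext g
    rw [Finset.sum_apply]
    by_cases hg : ∃ q ∈ F, g ∈ cylinder q.1 q.2
    · obtain ⟨q, hqF, hgq⟩ := hg
      rw [Finset.sum_eq_single q]
      · simp [Set.indicator_of_mem hgq, hc q hqF g hgq]
      · intro q' hq' hne
        have hq'F := hFfin.mem_toFinset.1 hq'
        rw [Pi.smul_apply, Set.indicator_of_notMem, smul_zero]
        intro hgq'
        obtain ⟨e1, e2⟩ := eq_of_mem_cylinder hgq' hgq
          ((hFP hq'F).2.1.trans (hFP hqF).2.1.symm)
        exact hne (Prod.ext e1 e2)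
      · intro h
        exact absurd (hFfin.mem_toFinset.2 hqF) h
    · rw [Finset.sum_eq_zero]
      · by_contra hne
        obtain ⟨q, hq, hgq⟩ := Set.mem_iUnion₂.1 (hF (subset_tsupport f hne))
        exact hg ⟨q, hq, hgq⟩
      · intro q hq
        rw [Pi.smul_apply, Set.indicator_of_notMem, smul_zero]
        exact fun hgq => hg ⟨q, hFfin.mem_toFinset.1 hq, hgq⟩
  rw [hfeq]
  refine Submodule.sum_mem _ fun q hq => Submodule.smul_mem _ _ (Submodule.subset_span ?_)
  exact ⟨q.1, q.2, (hFP (hFfin.mem_toFinset.1 hq)).1, rfl⟩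

/-- Every range fibre meets a cylinder in at most one point. -/
theorem finite_rng_fibre {f : Λ.PathGroupoid → ℂ}
    (hf : f ∈ leavittGroupoidAlgebra Λ.PathGroupoid) (x : Λ.InfPath) :
    {g : Λ.PathGroupoid | g.rng = x ∧ f g ≠ 0}.Finite := by
  have hspan := mem_span_indicator_cylinder hf
  clear hf
  induction hspan using Submodule.span_induction with
  | mem u hu =>
    obtain ⟨a, b, -, rfl⟩ := hu
    refine Set.Subsingleton.finite ?_
    rintro g ⟨hg, hga⟩ g' ⟨hg', hga'⟩
    have h := Set.mem_of_indicator_ne_zero hga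
    have h' := Set.mem_of_indicator_ne_zero hga'
    refine PathGroupoid.ext (hg.trans hg'.symm) ?_ (eq_of_seg_of_shift
      (h.2.1.trans h'.2.1.symm) ?_)
    · funext i
      rw [h.2.2.2 i, h'.2.2.2 i]
    · rw [← h.2.2.1, ← h'.2.2.1, hg, hg']
  | zero => simp
  | add u w _ _ hu hw =>
    refine (hu.union hw).subset ?_
    rintro g ⟨hg, hne⟩
    by_cases h : u g = 0
    · exact Or.inr ⟨hg, fun h' => hne (by simp [h, h'])⟩
    · exact Or.inl ⟨hg, h⟩
  | smul r u _ hu =>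
    refine hu.subset ?_
    rintro g ⟨hg, hne⟩
    exact ⟨hg, fun h => hne (by simp [h])⟩

end Topology

/-! ### Kumjian-Pask families -/

/-- A Kumjian-Pask `Λ`-family in a ring `B`: elements `s a` and `t a` (standing for `s_a` and
`s_{a*}`) that satisfy the Kumjian-Pask relations, where the idempotent `p_v` is encoded as
`s (one v)`. -/
structure KPFamily {k : ℕ} (Λ : KGraph.{u, v} k) (B : Type w) [Ring B] where
  s : Λ.Path → B
  t : Λ.Path → B
  t_one : ∀ a, t (Λ.one a) = s (Λ.one a)
  orth : ∀ a b, a ≠ b → s (Λ.one a) * s (Λ.one b) = 0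
  s_mul_s : ∀ a b, Λ.s a = Λ.r b → s a * s b = s (Λ.mul a b)
  t_mul_t : ∀ a b, Λ.s a = Λ.r b → t b * t a = t (Λ.mul a b)
  t_mul_s_self : ∀ a, t a * s a = s (Λ.one (Λ.s a))
  t_mul_s_of_ne : ∀ a b, Λ.d a = Λ.d b → a ≠ b → t a * s b = 0
  one_eq_sum : ∀ (a : Λ.Vert) (n : Fin k → ℕ) (F : Finset Λ.Path),
    (F : Set Λ.Path) = Λ.pathsFrom a n → s (Λ.one a) = ∑ c ∈ F, s c * t c

namespace KPFamily

variable {k : ℕ} {Λ : KGraph.{u, v} k} {B : Type w} [Ring B] (S : Λ.KPFamily B)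
  {a b c : Λ.Path}

theorem one_mul_one (a : Λ.Vert) : S.s (Λ.one a) * S.s (Λ.one a) = S.s (Λ.one a) := by
  have e := one_mul (Λ.one a)
  rw [Λ.r_one] at e
  rw [S.s_mul_s _ _ ((Λ.s_one a).trans (Λ.r_one a).symm), e]

theorem one_mul_s (a) : S.s (Λ.one (Λ.r a)) * S.s a = S.s a := by
  rw [S.s_mul_s _ _ (Λ.s_one _), one_mul]

theorem s_mul_one (a) : S.s a * S.s (Λ.one (Λ.s a)) = S.s a := by
  rw [S.s_mul_s _ _ (Λ.r_one _).symm, mul_one]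

theorem one_mul_t (a) : S.s (Λ.one (Λ.s a)) * S.t a = S.t a := by
  rw [← S.t_one, S.t_mul_t _ _ (Λ.r_one _).symm, mul_one]

theorem t_mul_one (a) : S.t a * S.s (Λ.one (Λ.r a)) = S.t a := by
  rw [← S.t_one, S.t_mul_t _ _ (Λ.s_one _), one_mul]

theorem s_mul_s_eq_zero (h : Λ.s a ≠ Λ.r b) : S.s a * S.s b = 0 := by
  rw [← S.s_mul_one a, ← S.one_mul_s b, _root_.mul_assoc, ← _root_.mul_assoc (S.s (Λ.one _)),
    S.orth _ _ h, zero_mul, mul_zero]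

theorem t_mul_t_eq_zero (h : Λ.s a ≠ Λ.r b) : S.t b * S.t a = 0 := by
  rw [← S.t_mul_one b, ← S.one_mul_t a, _root_.mul_assoc, ← _root_.mul_assoc (S.s (Λ.one _)),
    S.orth _ _ h.symm, zero_mul, mul_zero]

theorem t_mul_s_eq_zero (h : Λ.r a ≠ Λ.r b) : S.t a * S.s b = 0 := by
  rw [← S.t_mul_one a, ← S.one_mul_s b, _root_.mul_assoc, ← _root_.mul_assoc (S.s (Λ.one _)),
    S.orth _ _ h, zero_mul, mul_zero]

theorem s_mul_t_eq_zero (h : Λ.s a ≠ Λ.s b) : S.s a * S.t b = 0 := by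
  rw [← S.s_mul_one a, ← S.one_mul_t b, _root_.mul_assoc, ← _root_.mul_assoc (S.s (Λ.one _)),
    S.orth _ _ h, zero_mul, mul_zero]

/-- `s_{a*} s_{ac} = s_c`. -/
theorem t_mul_s_mul (h : Λ.s a = Λ.r c) : S.t a * S.s (Λ.mul a c) = S.s c := by
  rw [← S.s_mul_s _ _ h, ← _root_.mul_assoc, S.t_mul_s_self, h, S.one_mul_s]

/-- `s_{(ac)*} s_a = s_{c*}`. -/
theorem t_mul_mul_s (h : Λ.s a = Λ.r c) : S.t (Λ.mul a c) * S.s a = S.t c := by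
  rw [← S.t_mul_t _ _ h, _root_.mul_assoc, S.t_mul_s_self, h, S.t_mul_one]

theorem t_mul_s_mul_of_ne (h : Λ.s b = Λ.r c) (hd : Λ.d a = Λ.d b) (hne : a ≠ b) :
    S.t a * S.s (Λ.mul b c) = 0 := by
  rw [← S.s_mul_s _ _ h, ← _root_.mul_assoc, S.t_mul_s_of_ne _ _ hd hne, zero_mul]

theorem t_mul_mul_s_of_ne (h : Λ.s b = Λ.r c) (hd : Λ.d b = Λ.d a) (hne : b ≠ a) :
    S.t (Λ.mul b c) * S.s a = 0 := by
  rw [← S.t_mul_t _ _ h, _root_.mul_assoc, S.t_mul_s_of_ne _ _ hd hne, mul_zero]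

theorem s_mul_t_eq_sum (h : Λ.s a = Λ.s b) (n : Fin k → ℕ) (F : Finset Λ.Path)
    (hF : (F : Set Λ.Path) = Λ.pathsFrom (Λ.s a) n) :
    S.s a * S.t b = ∑ c ∈ F, S.s (Λ.mul a c) * S.t (Λ.mul b c) := by
  rw [← S.s_mul_one a, S.one_eq_sum _ n F hF, Finset.mul_sum, Finset.sum_mul]
  refine Finset.sum_congr rfl fun c hc => ?_
  have hr : Λ.r c = Λ.s a := (show c ∈ Λ.pathsFrom (Λ.s a) n from hF ▸ hc).1
  rw [← S.s_mul_s _ _ hr.symm, ← S.t_mul_t _ _ (h.symm.trans hr.symm)]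
  simp only [_root_.mul_assoc]

variable [Algebra ℂ B]

/-- The span of the elements `s_a s_{b*}` with `s(a) = s(b)`. -/
def span : Submodule ℂ B := Submodule.span ℂ {x | ∃ a b, Λ.s a = Λ.s b ∧ x = S.s a * S.t b}

theorem s_mul_t_mem (a b) : S.s a * S.t b ∈ S.span := by
  by_cases h : Λ.s a = Λ.s b
  · exact Submodule.subset_span ⟨a, b, h, rfl⟩
  · rw [S.s_mul_t_eq_zero h]
    exact zero_mem _

theorem s_mem (a) : S.s a ∈ S.span := by
  rw [← S.s_mul_one a, ← S.t_one]
  exact S.s_mul_t_mem _ _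

theorem t_mem (a) : S.t a ∈ S.span := by
  rw [← S.one_mul_t a]
  exact S.s_mul_t_mem _ _

theorem s_mul_mem (a) {x : B} (hx : x ∈ S.span) : S.s a * x ∈ S.span := by
  induction hx using Submodule.span_induction with
  | mem x hx =>
    obtain ⟨b, c, -, rfl⟩ := hx
    rw [← _root_.mul_assoc]
    by_cases h : Λ.s a = Λ.r b
    · rw [S.s_mul_s _ _ h]
      exact S.s_mul_t_mem _ _
    · rw [S.s_mul_s_eq_zero h, zero_mul]
      exact zero_mem _
  | zero => simp
  | add x y _ _ hx hy => rw [mul_add]; exact add_mem hx hy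
  | smul r x _ hx => rw [mul_smul_comm]; exact Submodule.smul_mem _ _ hx

theorem mul_t_mem (a) {x : B} (hx : x ∈ S.span) : x * S.t a ∈ S.span := by
  induction hx using Submodule.span_induction with
  | mem x hx =>
    obtain ⟨b, c, -, rfl⟩ := hx
    rw [_root_.mul_assoc]
    by_cases h : Λ.s a = Λ.r c
    · rw [S.t_mul_t _ _ h]
      exact S.s_mul_t_mem _ _
    · rw [S.t_mul_t_eq_zero h, mul_zero]
      exact zero_mem _
  | zero => simp
  | add x y _ _ hx hy => rw [add_mul]; exact add_mem hx hy
  | smul r x _ hx => rw [smul_mul_assoc]; exact Submodule.smul_mem _ _ hx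

/-- Inserting `p_{r(a)} = ∑ s_c s_{c*}`, over the paths `c` of degree `d(a) ∨ d(b)`, between
`s_{a*}` and `s_b` leaves only those `c` that extend both `a` and `b`. -/
theorem t_mul_s_mem (hrf : Λ.RowFinite) (a b) : S.t a * S.s b ∈ S.span := by
  by_cases h : Λ.r a = Λ.r b
  swap
  · rw [S.t_mul_s_eq_zero h]
    exact zero_mem _
  have hF := (hrf (Λ.r a) (Λ.d a ⊔ Λ.d b)).coe_toFinset
  rw [← S.t_mul_one a, S.one_eq_sum _ _ _ hF, Finset.mul_sum, Finset.sum_mul]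
  refine Submodule.sum_mem _ fun c hc => ?_
  obtain ⟨-, hd⟩ := (Set.Finite.mem_toFinset _).1 hc
  rw [_root_.mul_assoc, _root_.mul_assoc, ← _root_.mul_assoc]
  obtain ⟨a', e, h1, h2, rfl⟩ := exists_mul_eq (a := c) (hd.ge.trans' le_sup_left)
  obtain ⟨b', f, h3, h4, h5⟩ := exists_mul_eq (hd.ge.trans' (le_sup_right : Λ.d b ≤ _))
  by_cases ha : a = a'
  swap
  · rw [S.t_mul_s_mul_of_ne h1 h2.symm ha, zero_mul]
    exact zero_mem _
  by_cases hb : b' = b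
  swap
  · rw [← h5, S.t_mul_mul_s_of_ne h3 h4 hb, mul_zero]
    exact zero_mem _
  subst ha hb
  rw [S.t_mul_s_mul h1, ← h5, S.t_mul_mul_s h3]
  exact S.s_mul_t_mem _ _

theorem mul_mem (hrf : Λ.RowFinite) {x y : B} (hx : x ∈ S.span) (hy : y ∈ S.span) :
    x * y ∈ S.span := by
  induction hx using Submodule.span_induction with
  | mem x hx =>
    obtain ⟨a, b, -, rfl⟩ := hx
    induction hy using Submodule.span_induction with
    | mem y hy =>
      obtain ⟨c, e, -, rfl⟩ := hy
      have := S.mul_t_mem e (S.s_mul_mem a (S.t_mul_s_mem hrf b c))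
      simpa only [_root_.mul_assoc] using this
    | zero => simp
    | add x y _ _ hx hy => rw [mul_add]; exact add_mem hx hy
    | smul r x _ hx => rw [mul_smul_comm]; exact Submodule.smul_mem _ _ hx
  | zero => simp
  | add x y _ _ hx hy => rw [add_mul]; exact add_mem hx hy
  | smul r x _ hx => rw [smul_mul_assoc]; exact Submodule.smul_mem _ _ hx

/-- A non-unital subalgebra generated by elements of the span, and containing the family, is the
span. -/
theorem mem_adjoin_iff (hrf : Λ.RowFinite) {X : Set B} (hX : X ⊆ S.span)
    (hs : ∀ a, S.s a ∈ NonUnitalAlgebra.adjoin ℂ X)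
    (ht : ∀ a, S.t a ∈ NonUnitalAlgebra.adjoin ℂ X) (x : B) :
    x ∈ NonUnitalAlgebra.adjoin ℂ X ↔ x ∈ S.span := by
  constructor
  · intro hx
    induction hx using NonUnitalAlgebra.adjoin_induction with
    | mem x hx => exact hX hx
    | add x y _ _ hx hy => exact add_mem hx hy
    | zero => exact zero_mem _
    | mul x y _ _ hx hy => exact S.mul_mem hrf hx hy
    | smul r x _ hx => exact Submodule.smul_mem _ _ hx
  · intro hx
    induction hx using Submodule.span_induction with
    | mem x hx =>
      obtain ⟨a, b, -, rfl⟩ := hx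
      exact MulMemClass.mul_mem (hs a) (ht b)
    | zero => exact zero_mem _
    | add x y _ _ hx hy => exact add_mem hx hy
    | smul r x _ hx => exact SMulMemClass.smul_mem r hx

/-- The span of the elements `s_a s_{b*}` with `s(a) = s(b)` and `d(a) = n`. -/
def spanDeg (n : Fin k → ℕ) : Submodule ℂ B :=
  Submodule.span ℂ (Set.range fun q : {q : Λ.Path × Λ.Path // Λ.s q.1 = Λ.s q.2 ∧ Λ.d q.1 = n} =>
    S.s q.1.1 * S.t q.1.2)

/-- For `m ≤ n`, inserting `p_{s(a)} = ∑ s_c s_{c*}` over the paths `c` of degree `n - m` rewrites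
`s_a s_{b*}` in terms of longer paths. -/
theorem spanDeg_mono (hrf : Λ.RowFinite) : Monotone S.spanDeg := by
  intro m n hmn
  refine Submodule.span_le.2 ?_
  rintro _ ⟨⟨⟨a, b⟩, h, rfl⟩, rfl⟩
  change S.s a * S.t b ∈ S.spanDeg n
  rw [S.s_mul_t_eq_sum h (n - Λ.d a) _ (hrf _ _).coe_toFinset]
  refine Submodule.sum_mem _ fun c hc => Submodule.subset_span ?_
  obtain ⟨hr, hd⟩ := (Set.Finite.mem_toFinset _).1 hc
  have h1 : Λ.s a = Λ.r c := hr.symm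
  have h2 : Λ.s b = Λ.r c := h.symm.trans h1
  exact ⟨⟨(Λ.mul a c, Λ.mul b c), (s_mul h1).trans (s_mul h2).symm,
    (d_mul h1).trans (by rw [hd]; exact add_tsub_cancel_of_le hmn)⟩, rfl⟩

theorem exists_mem_spanDeg (hrf : Λ.RowFinite) {x : B} (hx : x ∈ S.span) :
    ∃ n, x ∈ S.spanDeg n := by
  induction hx using Submodule.span_induction with
  | mem x hx =>
    obtain ⟨a, b, h, rfl⟩ := hx
    exact ⟨Λ.d a, Submodule.subset_span ⟨⟨(a, b), h, rfl⟩, rfl⟩⟩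
  | zero => exact ⟨0, zero_mem _⟩
  | add x y _ _ hx hy =>
    obtain ⟨m, hm⟩ := hx
    obtain ⟨n, hn⟩ := hy
    exact ⟨m ⊔ n, add_mem (S.spanDeg_mono hrf le_sup_left hm) (S.spanDeg_mono hrf le_sup_right hn)⟩
  | smul r x _ hx =>
    obtain ⟨n, hn⟩ := hx
    exact ⟨n, Submodule.smul_mem _ _ hn⟩

end KPFamily

/-! ### The path representation -/

section PathRep

open InfPath

variable {k : ℕ} (Λ : KGraph.{u, v} k)

/-- The space with basis `Λ^∞ × ℤ^k` of the path representation. The second component keeps track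
of the degree. -/
abbrev PathSpace := (Λ.InfPath × (Fin k → ℤ)) →₀ ℂ

variable {Λ} {a b c : Λ.Path} {x y : Λ.InfPath} {m n : Fin k → ℤ}

/-- The degree of a path as an element of `ℤ^k`. -/
def degZ (a : Λ.Path) : Fin k → ℤ := fun i => (Λ.d a i : ℤ)

theorem degZ_one (a : Λ.Vert) : degZ (Λ.one a) = 0 := by
  funext i; simp [degZ, Λ.d_one]

theorem degZ_mul (h : Λ.s a = Λ.r b) : degZ (Λ.mul a b) = degZ a + degZ b := by
  funext i; simp [degZ, d_mul h]

open scoped Classical in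
/-- The operator `(x, n) ↦ (ax, n + d(a))` on basis vectors, zero when `s(a) ≠ r(x)`. -/
noncomputable def realOp (a : Λ.Path) : Module.End ℂ Λ.PathSpace :=
  Finsupp.linearCombination ℂ fun q =>
    if Λ.s a = q.1.obj 0 then Finsupp.single (cons a q.1, q.2 + degZ a) 1 else 0

open scoped Classical in
/-- The operator `(ax, n) ↦ (x, n - d(a))` on basis vectors, zero on those whose first component
does not begin with `a`. -/
noncomputable def ghostOp (a : Λ.Path) : Module.End ℂ Λ.PathSpace :=
  Finsupp.linearCombination ℂ fun q =>
    if q.1.seg (Λ.d a) = a then Finsupp.single (q.1.shift (Λ.d a), q.2 - degZ a) 1 else 0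

theorem realOp_single (h : Λ.s a = x.obj 0) :
    realOp a (Finsupp.single (x, n) 1) = Finsupp.single (cons a x, n + degZ a) 1 := by
  simp [realOp, h]

theorem realOp_single_of_ne (h : Λ.s a ≠ x.obj 0) : realOp a (Finsupp.single (x, n) 1) = 0 := by
  simp [realOp, h]

theorem ghostOp_single (h : x.seg (Λ.d a) = a) :
    ghostOp a (Finsupp.single (x, n) 1) = Finsupp.single (x.shift (Λ.d a), n - degZ a) 1 := by
  simp [ghostOp, h]

theorem ghostOp_single_of_ne (h : x.seg (Λ.d a) ≠ a) :
    ghostOp a (Finsupp.single (x, n) 1) = 0 := by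
  simp [ghostOp, h]

theorem realOp_one_single (x : Λ.InfPath) (n) :
    realOp (Λ.one (x.obj 0)) (Finsupp.single (x, n) 1) = Finsupp.single (x, n) 1 := by
  rw [realOp_single (Λ.s_one _), cons_one (Λ.s_one _), degZ_one, add_zero]

theorem realOp_one_single_of_ne {a : Λ.Vert} (h : a ≠ x.obj 0) :
    realOp (Λ.one a) (Finsupp.single (x, n) 1) = 0 :=
  realOp_single_of_ne (by rwa [Λ.s_one])

theorem realOp_ghostOp_single (h : x.seg (Λ.d a) = a) :
    realOp a (ghostOp a (Finsupp.single (x, n) 1)) = Finsupp.single (x, n) 1 := by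
  rw [ghostOp_single h, realOp_single (s_of_seg_eq h), cons_shift h, sub_add_cancel]

theorem end_ext {T T' : Module.End ℂ Λ.PathSpace}
    (h : ∀ x n, T (Finsupp.single (x, n) 1) = T' (Finsupp.single (x, n) 1)) : T = T' := by
  refine Finsupp.lhom_ext' fun q => LinearMap.ext_ring ?_
  exact h q.1 q.2

variable (Λ) in
/-- The Kumjian-Pask family of operators on the path space. -/
noncomputable def pathFamily : Λ.KPFamily (Module.End ℂ Λ.PathSpace) where
  s := realOp
  t := ghostOp
  t_one a := by
    refine end_ext fun x n => ?_
    by_cases h : a = x.obj 0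
    · subst h
      rw [realOp_one_single, ghostOp_single (by rw [Λ.d_one, seg_zero]), Λ.d_one, shift_zero,
        degZ_one, sub_zero]
    · rw [realOp_one_single_of_ne h, ghostOp_single_of_ne]
      rw [Λ.d_one, seg_zero]
      intro h'
      exact h (by rw [← Λ.r_one a, ← h', Λ.r_one])
  orth a b hab := by
    refine end_ext fun x n => ?_
    rw [Module.End.mul_apply]
    by_cases h : b = x.obj 0
    · subst h
      rw [realOp_one_single, realOp_one_single_of_ne hab]
      rfl
    · rw [realOp_one_single_of_ne h, map_zero]
      rfl
  s_mul_s a b hab := by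
    refine end_ext fun x n => ?_
    rw [Module.End.mul_apply]
    by_cases h : Λ.s b = x.obj 0
    · rw [realOp_single h, realOp_single (by rw [obj_cons h, hab]),
        realOp_single (by rw [s_mul hab, h]), cons_cons hab h, degZ_mul hab, add_right_comm,
        add_assoc]
    · rw [realOp_single_of_ne h, realOp_single_of_ne (by rwa [s_mul hab]), map_zero]
  t_mul_t a b hab := by
    refine end_ext fun x n => ?_
    rw [Module.End.mul_apply]
    have key := seg_add_eq_mul_iff (x := x) hab
    rw [← d_mul hab] at key
    by_cases h : x.seg (Λ.d a) = a
    · by_cases h' : (x.shift (Λ.d a)).seg (Λ.d b) = b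
      · rw [ghostOp_single h, ghostOp_single h', ghostOp_single (key.2 ⟨h, h'⟩), shift_shift,
          d_mul hab, degZ_mul hab, add_comm, sub_sub]
      · rw [ghostOp_single h, ghostOp_single_of_ne h',
          ghostOp_single_of_ne fun h'' => h' (key.1 h'').2]
    · rw [ghostOp_single_of_ne h, ghostOp_single_of_ne fun h'' => h (key.1 h'').1, map_zero]
  t_mul_s_self a := by
    refine end_ext fun x n => ?_
    rw [Module.End.mul_apply]
    by_cases h : Λ.s a = x.obj 0
    · rw [realOp_single h, ghostOp_single (seg_cons h), h, realOp_one_single, shift_cons h,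
        add_sub_cancel_right]
    · rw [realOp_single_of_ne h, realOp_one_single_of_ne h, map_zero]
  t_mul_s_of_ne a b hd hab := by
    refine end_ext fun x n => ?_
    rw [Module.End.mul_apply]
    by_cases h : Λ.s b = x.obj 0
    · rw [realOp_single h, ghostOp_single_of_ne]
      · rfl
      · rw [hd, seg_cons h]
        exact hab.symm
    · rw [realOp_single_of_ne h, map_zero]
      rfl
  one_eq_sum a n F hF := by
    refine end_ext fun x m => ?_
    rw [LinearMap.sum_apply]
    simp only [Module.End.mul_apply]
    have hF' : ∀ c, c ∈ F ↔ Λ.r c = a ∧ Λ.d c = n := fun c => by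
      rw [← Finset.mem_coe, hF]; rfl
    by_cases h : a = x.obj 0
    · subst h
      rw [realOp_one_single, Finset.sum_eq_single (x.seg n), realOp_ghostOp_single]
      · rw [d_seg]
      · intro c hc hne
        rw [ghostOp_single_of_ne, map_zero]
        rw [((hF' c).1 hc).2]
        exact hne.symm
      · intro h'
        exact absurd ((hF' _).2 ⟨x.r_seg n, x.d_seg n⟩) h'
    · rw [realOp_one_single_of_ne h, Finset.sum_eq_zero]
      intro c hc
      rw [ghostOp_single_of_ne, map_zero]
      intro h'
      exact h (by rw [← ((hF' c).1 hc).1, ← h', r_seg])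

open scoped Classical in
/-- The matrix coefficients of `s_a s_{b*}`. -/
theorem realOp_mul_ghostOp_apply (h : Λ.s a = Λ.s b) (x y m n) :
    (realOp a * ghostOp b) (Finsupp.single (y, m) 1) (x, n) =
      if x.seg (Λ.d a) = a ∧ y.seg (Λ.d b) = b ∧ x.shift (Λ.d a) = y.shift (Λ.d b) ∧
        n - m = degZ a - degZ b then 1 else 0 := by
  rw [Module.End.mul_apply]
  by_cases hy : y.seg (Λ.d b) = b
  · have hc : Λ.s a = (y.shift (Λ.d b)).obj 0 := h.trans (s_of_seg_eq hy)
    rw [ghostOp_single hy, realOp_single hc, Finsupp.single_apply]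
    refine if_congr ?_ rfl rfl
    rw [Prod.ext_iff]
    simp only [cons_eq_iff hc]
    constructor
    · rintro ⟨⟨h1, h2⟩, h3⟩
      exact ⟨h1, hy, h2, by rw [← h3]; abel⟩
    · rintro ⟨h1, -, h2, h3⟩
      exact ⟨⟨h1, h2⟩, by rw [sub_eq_iff_eq_add] at h3; rw [h3]; abel⟩
  · rw [ghostOp_single_of_ne hy, map_zero, if_neg fun h' => hy h'.2.1]
    rfl

variable {T T' : Module.End ℂ Λ.PathSpace}

/-- Operators in the span of the path family are invariant under translation of the degree. -/
theorem apply_single_eq_of_mem_span (hT : T ∈ (pathFamily Λ).span) (x y m n) :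
    T (Finsupp.single (y, m) 1) (x, n) = T (Finsupp.single (y, 0) 1) (x, n - m) := by
  classical
  induction hT using Submodule.span_induction with
  | mem T hT =>
    obtain ⟨a, b, h, rfl⟩ := hT
    simp only [pathFamily, realOp_mul_ghostOp_apply h, sub_zero]
  | zero => rfl
  | add T T' _ _ h h' => simp only [LinearMap.add_apply, Finsupp.add_apply, h, h']
  | smul r T _ h => simp only [LinearMap.smul_apply, Finsupp.smul_apply, h]

/-- The matrix coefficients of an operator in the span of the path family are supported on the
path groupoid. -/
theorem exists_of_apply_single_ne_zero (hT : T ∈ (pathFamily Λ).span)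
    (hne : T (Finsupp.single (y, m) 1) (x, n) ≠ 0) :
    ∃ g : Λ.PathGroupoid, g.rng = x ∧ g.src = y ∧ g.lag = n - m := by
  classical
  by_contra hg
  apply hne
  clear hne
  induction hT using Submodule.span_induction with
  | mem T hT =>
    obtain ⟨a, b, h, rfl⟩ := hT
    refine (realOp_mul_ghostOp_apply h _ _ _ _).trans (if_neg ?_)
    rintro ⟨-, -, h3, h4⟩
    exact hg ⟨⟨x, n - m, y, Λ.d a, Λ.d b, h3, fun i => congrFun h4 i⟩, rfl, rfl, rfl⟩
  | zero => rfl
  | add T T' _ _ h h' => simp only [LinearMap.add_apply, Finsupp.add_apply, h, h', add_zero]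
  | smul r T _ h => simp only [LinearMap.smul_apply, Finsupp.smul_apply, h, smul_zero]

variable (Λ) in
/-- The function on the path groupoid given by the matrix coefficients of an operator. -/
noncomputable def coeff : Module.End ℂ Λ.PathSpace →ₗ[ℂ] (Λ.PathGroupoid → ℂ) where
  toFun T g := T (Finsupp.single (g.src, 0) 1) (g.rng, g.lag)
  map_add' _ _ := rfl
  map_smul' _ _ := rfl

theorem coeff_realOp_mul_ghostOp (h : Λ.s a = Λ.s b) :
    coeff Λ (realOp a * ghostOp b) = (cylinder a b).indicator 1 := by
  classical
  funext g
  rw [Set.indicator_apply]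
  refine (realOp_mul_ghostOp_apply h _ _ _ _).trans (if_congr ?_ rfl rfl)
  rw [sub_zero, funext_iff]
  rfl

/-- The matrix of a product is the product of the matrices; by translation invariance, and because
the coefficients vanish off the groupoid, the matrix product is a convolution. -/
theorem coeff_mul (hT : T ∈ (pathFamily Λ).span) :
    coeff Λ (T * T') = Λ.groupoid.conv (coeff Λ T) (coeff Λ T') := by
  funext g
  let w : Λ.PathSpace := T' (Finsupp.single (g.src, 0) 1)
  -- The matrix product is the sum of `F`; an arrow `h` of the convolution sum corresponds to `e h`.
  let F : Λ.InfPath × (Fin k → ℤ) → ℂ := fun q =>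
    w q * T (Finsupp.single q 1) (g.rng, g.lag)
  let e : {h : Λ.PathGroupoid // h.rng = g.rng} → Λ.InfPath × (Fin k → ℤ) :=
    fun h => (h.1.src, g.lag - h.1.lag)
  have he : Function.Injective e := by
    rintro ⟨h, hr⟩ ⟨h', hr'⟩ hh
    obtain ⟨h1, h2⟩ := Prod.ext_iff.1 hh
    exact Subtype.ext (PathGroupoid.ext (hr.trans hr'.symm) (sub_right_injective h2) h1)
  have hF : ∀ q, F q ≠ 0 → q ∈ Set.range e := by
    intro q hq
    obtain ⟨h, h1, h2, h3⟩ := exists_of_apply_single_ne_zero hT (right_ne_zero_of_mul hq)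
    exact ⟨⟨h, h1⟩, Prod.ext h2 (by simp only [e, h3, sub_sub_cancel])⟩
  calc coeff Λ (T * T') g = T w (g.rng, g.lag) := rfl
    _ = ∑ q ∈ w.support, F q := by
      conv_lhs => rw [← w.sum_single, Finsupp.sum, map_sum, Finsupp.finsetSum_apply]
      refine Finset.sum_congr rfl fun q _ => ?_
      rw [← Finsupp.smul_single_one, map_smul]
      rfl
    _ = ∑ᶠ q, F q := by
      refine (finsum_eq_sum_of_support_subset _ fun q hq => ?_).symm
      exact Finsupp.mem_support_iff.2 (left_ne_zero_of_mul hq)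
    _ = ∑ᶠ q ∈ Set.range e, F q := by
      refine finsum_congr fun q => ?_
      by_cases hq : q ∈ Set.range e
      · simp only [hq, finsum_true]
      · simp only [hq, finsum_false]
        exact not_not.1 fun h => hq (hF q h)
    _ = ∑ᶠ h, F (e h) := finsum_mem_range he
    _ = Λ.groupoid.conv (coeff Λ T) (coeff Λ T') g := by
      refine finsum_congr fun h => ?_
      have h1 : T (Finsupp.single (e h) 1) (g.rng, g.lag) = coeff Λ T h.1 := by
        refine (apply_single_eq_of_mem_span hT _ _ _ _).trans ?_
        rw [sub_sub_cancel]
        exact congrArg (fun z => T (Finsupp.single (h.1.src, 0) 1) (z, h.1.lag)) h.2.symm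
      have h2 : w (e h) = coeff Λ T' (Λ.groupoid.mul (Λ.groupoid.inv h.1) g h.2) := by
        change w (h.1.src, g.lag - h.1.lag) = w (h.1.src, -h.1.lag + g.lag)
        rw [sub_eq_neg_add]
      exact (congrArg₂ _ h2 h1).trans (mul_comm _ _)

theorem coeff_mem (hrf : Λ.RowFinite) (hT : T ∈ (pathFamily Λ).span) :
    coeff Λ T ∈ leavittGroupoidAlgebra Λ.PathGroupoid := by
  induction hT using Submodule.span_induction with
  | mem T hT =>
    obtain ⟨a, b, h, rfl⟩ := hT
    change coeff Λ (realOp a * ghostOp b) ∈ _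
    rw [coeff_realOp_mul_ghostOp h]
    exact indicator_cylinder_mem hrf h
  | zero => rw [map_zero]; exact zero_mem _
  | add T T' _ _ h h' => rw [map_add]; exact add_mem h h'
  | smul r T _ h => rw [map_smul]; exact Submodule.smul_mem _ _ h

end PathRep

/-! ### The isomorphism for a represented Kumjian-Pask family -/

section Iso

variable {k : ℕ} {Λ : KGraph.{u, v} k} {B : Type w} [Ring B] [Algebra ℂ B] {S : Λ.KPFamily B}
  {π : B →ₐ[ℂ] Module.End ℂ Λ.PathSpace}

theorem map_mem_span (hs : ∀ a, π (S.s a) = realOp a) (ht : ∀ a, π (S.t a) = ghostOp a) {x : B}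
    (hx : x ∈ S.span) : π x ∈ (pathFamily Λ).span := by
  induction hx using Submodule.span_induction with
  | mem x hx =>
    obtain ⟨a, b, h, rfl⟩ := hx
    rw [map_mul, hs, ht]
    exact (pathFamily Λ).s_mul_t_mem a b
  | zero => rw [map_zero]; exact zero_mem _
  | add x y _ _ hx hy => rw [map_add]; exact add_mem hx hy
  | smul r x _ hx => rw [map_smul]; exact Submodule.smul_mem _ _ hx

/-- An element of the span is a combination of elements `s_a s_{b*}` with the same degree of `a`.
These are mapped to indicator functions of pairwise disjoint non-empty cylinders. -/
theorem eq_zero_of_coeff_eq_zero (hrf : Λ.RowFinite) (hns : Λ.NoSources)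
    (hs : ∀ a, π (S.s a) = realOp a) (ht : ∀ a, π (S.t a) = ghostOp a) {x : B}
    (hx : x ∈ S.span) (h0 : coeff Λ (π x) = 0) : x = 0 := by
  obtain ⟨n, hn⟩ := S.exists_mem_spanDeg hrf hx
  obtain ⟨c, rfl⟩ := (Finsupp.mem_span_range_iff_exists_finsupp).1 hn
  have hc : ∀ q, c q = 0 := by
    intro q
    by_contra hq
    obtain ⟨g, hg⟩ := cylinder_nonempty hns q.2.1
    have e := congrFun h0 g
    rw [Finsupp.sum, map_sum, map_sum, Finset.sum_apply, Finset.sum_eq_single q] at e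
    · rw [map_smul, map_smul, map_mul, hs, ht, coeff_realOp_mul_ghostOp q.2.1, Pi.smul_apply,
        Set.indicator_of_mem hg] at e
      simp [hq] at e
    · intro q' _ hne
      rw [map_smul, map_smul, map_mul, hs, ht, coeff_realOp_mul_ghostOp q'.2.1, Pi.smul_apply,
        Set.indicator_of_notMem, smul_zero]
      intro hg'
      obtain ⟨e1, e2⟩ := eq_of_mem_cylinder hg' hg (q'.2.2.trans q.2.2.symm)
      exact hne (Subtype.ext (Prod.ext e1 e2))
    · exact fun h => absurd (Finsupp.mem_support_iff.2 hq) h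
  rw [Finsupp.sum]
  exact Finset.sum_eq_zero fun q _ => by rw [hc, zero_smul]

/-- If a Kumjian-Pask family in `B` has a representation on the path space, then its span is
isomorphic to `A(G_Λ)`. -/
theorem exists_algebraIso (hrf : Λ.RowFinite) (hns : Λ.NoSources)
    (hs : ∀ a, π (S.s a) = realOp a) (ht : ∀ a, π (S.t a) = ghostOp a)
    (A : NonUnitalSubalgebra ℂ B) (hA : ∀ x, x ∈ A ↔ x ∈ S.span) :
    ∃ φ : A ≃ₗ[ℂ] leavittGroupoidAlgebra Λ.PathGroupoid, Λ.groupoid.IsAlgebraIso φ ∧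
      (∀ a, ∀ x : A, (x : B) = S.s (Λ.one a) →
        (φ x : Λ.PathGroupoid → ℂ) = (cylinder (Λ.one a) (Λ.one a)).indicator 1) ∧
      (∀ a, ∀ x : A, (x : B) = S.s a →
        (φ x : Λ.PathGroupoid → ℂ) = (cylinder a (Λ.one (Λ.s a))).indicator 1) ∧
      (∀ a, ∀ x : A, (x : B) = S.t a →
        (φ x : Λ.PathGroupoid → ℂ) = (cylinder (Λ.one (Λ.s a)) a).indicator 1) := by
  have hmem : ∀ x : A, π x ∈ (pathFamily Λ).span := fun x => map_mem_span hs ht ((hA _).1 x.2)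
  let L : A →ₗ[ℂ] leavittGroupoidAlgebra Λ.PathGroupoid :=
    { toFun := fun x => ⟨coeff Λ (π x), coeff_mem hrf (hmem x)⟩
      map_add' := fun x y => Subtype.ext (by simp)
      map_smul' := fun r x => Subtype.ext (by simp) }
  have hL : ∀ a b, Λ.s a = Λ.s b → ∀ x : A, (x : B) = S.s a * S.t b →
      (L x : Λ.PathGroupoid → ℂ) = (cylinder a b).indicator 1 := by
    intro a b h x hx
    change coeff Λ (π x) = _
    rw [hx, map_mul, hs, ht, coeff_realOp_mul_ghostOp h]
  have hinj : Function.Injective L := by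
    refine (injective_iff_map_eq_zero L).2 fun x hx => Subtype.ext ?_
    exact eq_zero_of_coeff_eq_zero hrf hns hs ht ((hA _).1 x.2) (congrArg Subtype.val hx)
  have hsurj : Function.Surjective L := by
    intro f
    have hf : (f : Λ.PathGroupoid → ℂ) ∈
        (LinearMap.range L).map (leavittGroupoidAlgebra Λ.PathGroupoid).subtype := by
      refine Submodule.span_le.2 ?_ (mem_span_indicator_cylinder f.2)
      rintro _ ⟨a, b, h, rfl⟩
      exact ⟨_, ⟨⟨_, (hA _).2 (S.s_mul_t_mem a b)⟩, rfl⟩, hL a b h _ rfl⟩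
    obtain ⟨_, ⟨x, rfl⟩, hx⟩ := hf
    exact ⟨x, Subtype.ext hx⟩
  refine ⟨LinearEquiv.ofBijective L ⟨hinj, hsurj⟩, ⟨fun f hf x => finite_rng_fibre hf x,
    fun x y => ?_⟩, fun a x hx => ?_, fun a x hx => ?_, fun a x hx => ?_⟩
  · change coeff Λ (π (x * y : B)) = _
    rw [map_mul]
    exact coeff_mul (hmem x)
  · refine hL _ _ rfl x (hx.trans ?_)
    conv_lhs => rw [← S.s_mul_one, Λ.s_one]
    rw [S.t_one]
  · exact hL _ _ (Λ.s_one _).symm x (hx.trans (by rw [S.t_one, S.s_mul_one]))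
  · exact hL _ _ (Λ.s_one _) x (hx.trans (S.one_mul_t a).symm)

end Iso

/-! ### The Kumjian-Pask algebra -/

section KumjianPask

variable {k : ℕ} (Λ : KGraph.{u, v} k)

/-- A generator of the Kumjian-Pask algebra, as an element of the unital algebra with the same
generators and relations. -/
noncomputable def kpGen (x : Λ.KPGen) : RingQuot Λ.KPRel :=
  RingQuot.mkAlgHom ℂ Λ.KPRel (FreeAlgebra.ι ℂ x)

variable {Λ} in
theorem kp_rel {p q : FreeAlgebra ℂ Λ.KPGen} (h : Λ.KPRel p q) :
    RingQuot.mkAlgHom ℂ Λ.KPRel p = RingQuot.mkAlgHom ℂ Λ.KPRel q :=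
  RingQuot.mkAlgHom_rel ℂ h

/-- The universal Kumjian-Pask family. -/
noncomputable def kpFamily : Λ.KPFamily (RingQuot Λ.KPRel) where
  s a := Λ.kpGen (.real a)
  t a := Λ.kpGen (.ghost a)
  t_one a := (kp_rel (.ghost_one a)).trans (kp_rel (.real_one a)).symm
  orth a b h := by
    have e : ∀ a, Λ.kpGen (.real (Λ.one a)) = Λ.kpGen (.vert a) := fun a => kp_rel (.real_one a)
    rw [e, e]
    simpa [kpGen] using kp_rel (.orth a b h)
  s_mul_s a b h := by
    rw [mul_eq h]
    simpa [kpGen] using kp_rel (.real_mul a b h)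
  t_mul_t a b h := by
    rw [mul_eq h]
    simpa [kpGen] using kp_rel (.ghost_mul a b h)
  t_mul_s_self a := by
    have e : Λ.kpGen (.real (Λ.one (Λ.s a))) = Λ.kpGen (.vert (Λ.s a)) := kp_rel (.real_one _)
    rw [e]
    simpa [kpGen] using kp_rel (.ghost_real a a rfl)
  t_mul_s_of_ne a b hd h := by
    simpa [kpGen, h] using kp_rel (.ghost_real a b hd)
  one_eq_sum a n F hF := by
    have e : Λ.kpGen (.real (Λ.one a)) = Λ.kpGen (.vert a) := kp_rel (.real_one _)
    rw [e]
    simpa [kpGen] using kp_rel (.sum a n F hF)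

variable {Λ} {B : Type w} [Ring B] [Algebra ℂ B]

/-- The images of the generators under the homomorphism given by a Kumjian-Pask family. -/
def KPFamily.onGen (S : Λ.KPFamily B) : Λ.KPGen → B
  | .vert a => S.s (Λ.one a)
  | .real a => S.s a
  | .ghost a => S.t a

/-- The homomorphism given by a Kumjian-Pask family. -/
noncomputable def KPFamily.lift (S : Λ.KPFamily B) : RingQuot Λ.KPRel →ₐ[ℂ] B :=
  RingQuot.liftAlgHom ℂ ⟨FreeAlgebra.lift ℂ S.onGen, by
    intro p q h
    induction h with
    | real_one a => simp [onGen]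
    | ghost_one a => simp [onGen, S.t_one]
    | idem a => simpa [onGen] using S.one_mul_one a
    | orth a b h => simpa [onGen] using S.orth a b h
    | real_mul a b h => simpa [onGen, mul_eq h] using S.s_mul_s a b h
    | ghost_mul a b h => simpa [onGen, mul_eq h] using S.t_mul_t a b h
    | r_real a => simpa [onGen] using S.one_mul_s a
    | real_s a => simpa [onGen] using S.s_mul_one a
    | s_ghost a => simpa [onGen] using S.one_mul_t a
    | ghost_r a => simpa [onGen] using S.t_mul_one a
    | ghost_real a b h =>
      by_cases hab : a = b
      · subst hab
        simpa [onGen] using S.t_mul_s_self a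
      · simpa [onGen, hab] using S.t_mul_s_of_ne a b h hab
    | sum a n F hF => simpa [onGen] using S.one_eq_sum a n F hF⟩

theorem KPFamily.lift_kpGen (S : Λ.KPFamily B) (x : Λ.KPGen) : S.lift (Λ.kpGen x) = S.onGen x := by
  simp [KPFamily.lift, kpGen]

theorem mem_kumjianPask_iff (hrf : Λ.RowFinite) (x : RingQuot Λ.KPRel) :
    x ∈ presentedAlgebra Λ.KPRel ↔ x ∈ Λ.kpFamily.span := by
  refine Λ.kpFamily.mem_adjoin_iff hrf ?_ (fun a => ?_) (fun a => ?_) x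
  · rintro _ ⟨y, rfl⟩
    cases y with
    | vert a =>
      have e : Λ.kpGen (.real (Λ.one a)) = Λ.kpGen (.vert a) := kp_rel (.real_one a)
      exact show Λ.kpGen (.vert a) ∈ Λ.kpFamily.span from e ▸ Λ.kpFamily.s_mem (Λ.one a)
    | real a => exact Λ.kpFamily.s_mem a
    | ghost a => exact Λ.kpFamily.t_mem a
  · exact NonUnitalAlgebra.subset_adjoin ℂ ⟨.real a, rfl⟩
  · exact NonUnitalAlgebra.subset_adjoin ℂ ⟨.ghost a, rfl⟩

theorem exists_kumjianPask_iso (hrf : Λ.RowFinite) (hns : Λ.NoSources) :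
    ∃ φ : Λ.KumjianPask ≃ₗ[ℂ] leavittGroupoidAlgebra Λ.PathGroupoid,
      Λ.groupoid.IsAlgebraIso φ ∧
      (∀ a, (φ (presentedAlgebra.gen _ (.vert a)) : Λ.PathGroupoid → ℂ) =
        (KGraph.cylinder (Λ.one a) (Λ.one a)).indicator 1) ∧
      (∀ a, (φ (presentedAlgebra.gen _ (.real a)) : Λ.PathGroupoid → ℂ) =
        (KGraph.cylinder a (Λ.one (Λ.s a))).indicator 1) ∧
      (∀ a, (φ (presentedAlgebra.gen _ (.ghost a)) : Λ.PathGroupoid → ℂ) =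
        (KGraph.cylinder (Λ.one (Λ.s a)) a).indicator 1) := by
  obtain ⟨φ, h1, h2, h3, h4⟩ := exists_algebraIso (S := Λ.kpFamily) (π := (pathFamily Λ).lift)
    hrf hns (fun a => (pathFamily Λ).lift_kpGen (.real a))
    (fun a => (pathFamily Λ).lift_kpGen (.ghost a)) _ (mem_kumjianPask_iff hrf)
  exact ⟨φ, h1, fun a => h2 a _ (kp_rel (.real_one a)).symm, fun a => h3 a _ rfl,
    fun a => h4 a _ rfl⟩

end KumjianPask

/-! ### The Leavitt path algebra of a `1`-graph -/

section Leavitt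

variable {Λ : KGraph.{u, v} 1}

/-- A Leavitt family for the edges of a `1`-graph in a ring: elements `p`, `s` and `t` satisfying
the relations of the Leavitt path algebra of a row-finite graph without sources. -/
structure EdgeFamily (Λ : KGraph.{u, v} 1) (B : Type w) [Ring B] where
  p : Λ.Vert → B
  s : Λ.Path → B
  t : Λ.Path → B
  idem : ∀ a, p a * p a = p a
  orth : ∀ a b, a ≠ b → p a * p b = 0
  p_mul_s : ∀ e, Λ.d e = 1 → p (Λ.r e) * s e = s e
  s_mul_p : ∀ e, Λ.d e = 1 → s e * p (Λ.s e) = s e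
  p_mul_t : ∀ e, Λ.d e = 1 → p (Λ.s e) * t e = t e
  t_mul_p : ∀ e, Λ.d e = 1 → t e * p (Λ.r e) = t e
  t_mul_s_self : ∀ e, Λ.d e = 1 → t e * s e = p (Λ.s e)
  t_mul_s_of_ne : ∀ e f, Λ.d e = 1 → Λ.d f = 1 → e ≠ f → t e * s f = 0
  p_eq_sum : ∀ (a : Λ.Vert) (F : Finset Λ.Path), (F : Set Λ.Path) = Λ.pathsFrom a 1 →
    p a = ∑ e ∈ F, s e * t e

namespace EdgeFamily

variable {B : Type w} [Ring B] (S : Λ.EdgeFamily B) {a b : Λ.Path} {n : ℕ}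

/-- The product `s_{e₁} ⋯ s_{eₙ}` along a path of degree `n` with the edges `e₁, …, eₙ`. -/
noncomputable def sPath : ℕ → Λ.Path → B
  | 0, a => S.p (Λ.r a)
  | n + 1, a => S.s (Λ.pre 1 a) * sPath n (Λ.suf 1 a)

/-- The product `t_{eₙ} ⋯ t_{e₁}` along a path of degree `n` with the edges `e₁, …, eₙ`. -/
noncomputable def tPath : ℕ → Λ.Path → B
  | 0, a => S.p (Λ.r a)
  | n + 1, a => tPath n (Λ.suf 1 a) * S.t (Λ.pre 1 a)

end EdgeFamily

/-- Paths of degree `n + 1` in a `1`-graph have the form `ea` with an edge `e` and `a` of degree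
`n`. -/
theorem exists_edge_mul {a : Λ.Path} {n : ℕ} (h : Λ.d a = fun _ => n + 1) :
    ∃ e b, Λ.s e = Λ.r b ∧ Λ.d e = 1 ∧ (Λ.d b = fun _ => n) ∧ Λ.mul e b = a := by
  have h1 : (1 : Fin 1 → ℕ) ≤ Λ.d a := fun i => by rw [h]; exact Nat.le_add_left 1 n
  obtain ⟨e, b, h2, h3, rfl⟩ := exists_mul_eq h1
  refine ⟨e, b, h2, h3, ?_, rfl⟩
  rw [d_mul h2, h3] at h
  funext i
  have := congrFun h i
  simp only [Pi.add_apply, Pi.one_apply] at this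
  omega

theorem d_eq_const (a : Λ.Path) : Λ.d a = fun _ => Λ.d a 0 := by
  funext i; rw [Subsingleton.elim i 0]

namespace EdgeFamily

variable {B : Type w} [Ring B] (S : Λ.EdgeFamily B) {a b e : Λ.Path} {n m : ℕ}

theorem sPath_mul (h : Λ.s e = Λ.r b) (he : Λ.d e = 1) :
    S.sPath (n + 1) (Λ.mul e b) = S.s e * S.sPath n b := by
  rw [sPath, pre_mul h he, suf_mul h he]

theorem tPath_mul (h : Λ.s e = Λ.r b) (he : Λ.d e = 1) :
    S.tPath (n + 1) (Λ.mul e b) = S.tPath n b * S.t e := by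
  rw [tPath, pre_mul h he, suf_mul h he]

theorem p_mul_sPath (h : Λ.d a = fun _ => n) : S.p (Λ.r a) * S.sPath n a = S.sPath n a := by
  cases n with
  | zero => exact S.idem _
  | succ n =>
    obtain ⟨e, b, h1, h2, -, rfl⟩ := exists_edge_mul h
    rw [S.sPath_mul h1 h2, r_mul, ← _root_.mul_assoc, S.p_mul_s e h2]

theorem tPath_mul_p (h : Λ.d a = fun _ => n) : S.tPath n a * S.p (Λ.r a) = S.tPath n a := by
  cases n with
  | zero => exact S.idem _
  | succ n =>
    obtain ⟨e, b, h1, h2, -, rfl⟩ := exists_edge_mul h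
    rw [S.tPath_mul h1 h2, r_mul, _root_.mul_assoc, S.t_mul_p e h2]

theorem sPath_mul_sPath (hb : Λ.d b = fun _ => m) : ∀ {n : ℕ} {a : Λ.Path},
    (Λ.d a = fun _ => n) → Λ.s a = Λ.r b →
      S.sPath n a * S.sPath m b = S.sPath (n + m) (Λ.mul a b)
  | 0, a, ha, h => by
    rw [eq_one_of_d_eq_zero ha, Λ.s_one] at h
    rw [eq_one_of_d_eq_zero ha, h, one_mul, sPath, Λ.r_one, S.p_mul_sPath hb, zero_add]
  | n + 1, a, ha, h => by
    obtain ⟨e, c, h1, h2, h3, rfl⟩ := exists_edge_mul ha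
    rw [s_mul h1] at h
    rw [mul_assoc h1 h, S.sPath_mul h1 h2, _root_.mul_assoc, sPath_mul_sPath hb h3 h,
      Nat.add_right_comm, S.sPath_mul (by rw [r_mul, h1]) h2]

theorem tPath_mul_tPath (hb : Λ.d b = fun _ => m) : ∀ {n : ℕ} {a : Λ.Path},
    (Λ.d a = fun _ => n) → Λ.s a = Λ.r b →
      S.tPath m b * S.tPath n a = S.tPath (n + m) (Λ.mul a b)
  | 0, a, ha, h => by
    rw [eq_one_of_d_eq_zero ha, Λ.s_one] at h
    rw [eq_one_of_d_eq_zero ha, h, one_mul, tPath, Λ.r_one, S.tPath_mul_p hb, zero_add]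
  | n + 1, a, ha, h => by
    obtain ⟨e, c, h1, h2, h3, rfl⟩ := exists_edge_mul ha
    rw [s_mul h1] at h
    rw [mul_assoc h1 h, S.tPath_mul h1 h2, ← _root_.mul_assoc, tPath_mul_tPath hb h3 h,
      Nat.add_right_comm, S.tPath_mul (by rw [r_mul, h1]) h2]

theorem tPath_mul_sPath_self : ∀ {n : ℕ} {a : Λ.Path}, (Λ.d a = fun _ => n) →
    S.tPath n a * S.sPath n a = S.p (Λ.s a)
  | 0, a, ha => by
    rw [eq_one_of_d_eq_zero ha, Λ.s_one, tPath, sPath, Λ.r_one, S.idem]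
  | n + 1, a, ha => by
    obtain ⟨e, c, h1, h2, h3, rfl⟩ := exists_edge_mul ha
    rw [S.tPath_mul h1 h2, S.sPath_mul h1 h2, _root_.mul_assoc, ← _root_.mul_assoc (S.t e),
      S.t_mul_s_self e h2, h1, S.p_mul_sPath h3, tPath_mul_sPath_self h3, s_mul h1]

theorem tPath_mul_sPath_of_ne : ∀ {n : ℕ} {a b : Λ.Path}, (Λ.d a = fun _ => n) →
    (Λ.d b = fun _ => n) → a ≠ b → S.tPath n a * S.sPath n b = 0
  | 0, a, b, ha, hb, h => by
    rw [eq_one_of_d_eq_zero ha, eq_one_of_d_eq_zero hb] at h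
    exact S.orth _ _ fun h' => h (by rw [h'])
  | n + 1, a, b, ha, hb, h => by
    obtain ⟨e, c, h1, h2, h3, rfl⟩ := exists_edge_mul ha
    obtain ⟨e', c', h1', h2', h3', rfl⟩ := exists_edge_mul hb
    rw [S.tPath_mul h1 h2, S.sPath_mul h1' h2', _root_.mul_assoc, ← _root_.mul_assoc (S.t e)]
    by_cases he : e = e'
    · subst he
      rw [S.t_mul_s_self e h2, h1', S.p_mul_sPath h3']
      exact tPath_mul_sPath_of_ne h3 h3' fun hc => h (by rw [hc])
    · rw [S.t_mul_s_of_ne e e' h2 h2' he, zero_mul, mul_zero]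

/-- The second Cuntz-Krieger relation for paths of degree `n + 1` follows by inserting the one for
degree `n` between `s_e` and `s_{e*}` for every edge `e`. -/
theorem p_eq_sum_path (hrf : Λ.RowFinite) : ∀ (n : ℕ) (a : Λ.Vert) (F : Finset Λ.Path),
    (∀ c, c ∈ F ↔ Λ.r c = a ∧ Λ.d c = fun _ => n) →
      S.p a = ∑ c ∈ F, S.sPath n c * S.tPath n c
  | 0, a, F, hF => by
    have : F = {Λ.one a} := by
      ext c
      rw [hF, Finset.mem_singleton]
      constructor
      · rintro ⟨rfl, h⟩
        exact eq_one_of_d_eq_zero h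
      · rintro rfl
        exact ⟨Λ.r_one a, Λ.d_one a⟩
    rw [this, Finset.sum_singleton, sPath, tPath, Λ.r_one, S.idem]
  | n + 1, a, F, hF => by
    let E : Λ.Vert → Finset Λ.Path := fun v => (hrf v 1).toFinset
    let G : Λ.Vert → Finset Λ.Path := fun v => (hrf v fun _ => n).toFinset
    have hE : ∀ {v c}, c ∈ E v ↔ Λ.r c = v ∧ Λ.d c = 1 := (hrf _ 1).mem_toFinset
    have hG : ∀ {v c}, c ∈ G v ↔ Λ.r c = v ∧ Λ.d c = fun _ => n :=
      (hrf _ fun _ => n).mem_toFinset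
    have h1 : ∀ e ∈ E a, S.s e * S.t e =
        ∑ c ∈ G (Λ.s e), S.sPath (n + 1) (Λ.mul e c) * S.tPath (n + 1) (Λ.mul e c) := by
      intro e he
      have he1 := (hE.1 he).2
      rw [← S.s_mul_p e he1, p_eq_sum_path hrf n (Λ.s e) (G (Λ.s e)) fun c => hG, Finset.mul_sum,
        Finset.sum_mul]
      refine Finset.sum_congr rfl fun c hc => ?_
      have hc1 := (hG.1 hc).1.symm
      rw [S.sPath_mul hc1 he1, S.tPath_mul hc1 he1]
      simp only [_root_.mul_assoc]
    rw [S.p_eq_sum a (E a) (hrf a 1).coe_toFinset, Finset.sum_congr rfl h1, Finset.sum_sigma']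
    refine Finset.sum_bij (fun q _ => Λ.mul q.1 q.2) ?_ ?_ ?_ fun _ _ => rfl
    · rintro ⟨e, c⟩ hq
      obtain ⟨he, hc⟩ := Finset.mem_sigma.1 hq
      obtain ⟨he1, he2⟩ := hE.1 he
      obtain ⟨hc1, hc2⟩ := hG.1 hc
      refine (hF _).2 ⟨(r_mul _ _).trans he1, (d_mul hc1.symm).trans ?_⟩
      rw [he2, hc2, add_comm]
      rfl
    · rintro ⟨e, c⟩ hq ⟨e', c'⟩ hq' h
      obtain ⟨he, hc⟩ := Finset.mem_sigma.1 hq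
      obtain ⟨he', hc'⟩ := Finset.mem_sigma.1 hq'
      obtain ⟨rfl, rfl⟩ := mul_inj (hG.1 hc).1.symm (hG.1 hc').1.symm
        ((hE.1 he).2.trans (hE.1 he').2.symm) h
      rfl
    · intro c hc
      obtain ⟨hc1, hc2⟩ := (hF c).1 hc
      obtain ⟨e, b, h1, h2, h3, rfl⟩ := exists_edge_mul hc2
      exact ⟨⟨e, b⟩, Finset.mem_sigma.2 ⟨hE.2 ⟨(r_mul _ _).symm.trans hc1, h2⟩,
        hG.2 ⟨h1.symm, h3⟩⟩, rfl⟩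

/-- The Kumjian-Pask family obtained from an edge family. -/
noncomputable def toKPFamily (hrf : Λ.RowFinite) : Λ.KPFamily B where
  s a := S.sPath (Λ.d a 0) a
  t a := S.tPath (Λ.d a 0) a
  t_one a := by simp only [Λ.d_one]; rfl
  orth a b h := by
    simp only [Λ.d_one, Pi.zero_apply, sPath, Λ.r_one]
    exact S.orth a b h
  s_mul_s a b h := by
    rw [S.sPath_mul_sPath (d_eq_const b) (d_eq_const a) h, d_mul h]
    rfl
  t_mul_t a b h := by
    rw [S.tPath_mul_tPath (d_eq_const b) (d_eq_const a) h, d_mul h]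
    rfl
  t_mul_s_self a := by
    rw [S.tPath_mul_sPath_self (d_eq_const a), Λ.d_one, Pi.zero_apply, sPath, Λ.r_one]
  t_mul_s_of_ne a b hd h := by
    rw [hd]
    exact S.tPath_mul_sPath_of_ne (hd ▸ d_eq_const a) (d_eq_const b) h
  one_eq_sum a n F hF := by
    have hn : n = fun _ => n 0 := by funext i; rw [Subsingleton.elim i 0]
    have hF' : ∀ c, c ∈ F ↔ Λ.r c = a ∧ Λ.d c = fun _ => n 0 := fun c => by
      rw [← Finset.mem_coe, hF, ← hn]; rfl
    rw [Λ.d_one, Pi.zero_apply, sPath, Λ.r_one, S.p_eq_sum_path hrf (n 0) a F hF']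
    refine Finset.sum_congr rfl fun c hc => ?_
    rw [((hF' c).1 hc).2]

theorem toKPFamily_s_one (hrf : Λ.RowFinite) (a : Λ.Vert) :
    (S.toKPFamily hrf).s (Λ.one a) = S.p a := by
  simp only [toKPFamily, Λ.d_one, Pi.zero_apply, sPath, Λ.r_one]

theorem toKPFamily_s (hrf : Λ.RowFinite) (h : Λ.d e = 1) : (S.toKPFamily hrf).s e = S.s e := by
  have h' := S.sPath_mul (n := 0) (Λ.r_one (Λ.s e)).symm h
  rw [mul_one, sPath, Λ.r_one, S.s_mul_p e h] at h'
  change S.sPath (Λ.d e 0) e = _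
  rwa [h]

theorem toKPFamily_t (hrf : Λ.RowFinite) (h : Λ.d e = 1) : (S.toKPFamily hrf).t e = S.t e := by
  have h' := S.tPath_mul (n := 0) (Λ.r_one (Λ.s e)).symm h
  rw [mul_one, tPath, Λ.r_one, S.p_mul_t e h] at h'
  change S.tPath (Λ.d e 0) e = _
  rwa [h]

end EdgeFamily

/-- Induction along the edges of a path of a `1`-graph. -/
theorem path_induction {P : Λ.Path → Prop} (one : ∀ a, P (Λ.one a))
    (mul : ∀ e b, Λ.s e = Λ.r b → Λ.d e = 1 → P b → P (Λ.mul e b)) (a : Λ.Path) : P a := by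
  have key : ∀ (n : ℕ) (a : Λ.Path), (Λ.d a = fun _ => n) → P a := by
    intro n
    induction n with
    | zero =>
      intro a ha
      rw [eq_one_of_d_eq_zero ha]
      exact one _
    | succ n ih =>
      intro a ha
      obtain ⟨e, b, h1, h2, h3, rfl⟩ := exists_edge_mul ha
      exact mul e b h1 h2 (ih b h3)
  exact key _ a (d_eq_const a)

variable {B : Type w} [Ring B]

/-- An edge of the graph of `Λ` as a path. -/
def edgePath (e : Λ.graph.Edge) : Λ.Path := e.1

/-- A path of degree `1` as an edge of the graph of `Λ`. -/
def edge (a : Λ.Path) (h : Λ.d a = 1) : Λ.graph.Edge := ⟨a, h⟩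

theorem d_edgePath (e : Λ.graph.Edge) : Λ.d (edgePath e) = 1 := e.2

theorem edgePath_injective : Function.Injective (edgePath : Λ.graph.Edge → Λ.Path) :=
  Subtype.val_injective

theorem edge_inj {a b : Λ.Path} {ha : Λ.d a = 1} {hb : Λ.d b = 1} (h : edge a ha = edge b hb) :
    a = b :=
  congrArg edgePath h

/-- The images of the generators of the Leavitt path algebra under the homomorphism given by a
Kumjian-Pask family. -/
def KPFamily.onEdgeGen (S : Λ.KPFamily B) : Λ.graph.LPGen → B
  | .vert a => S.s (Λ.one a)
  | .real e => S.s (edgePath e)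
  | .ghost e => S.t (edgePath e)

/-- The homomorphism from the Leavitt path algebra given by a Kumjian-Pask family. -/
noncomputable def KPFamily.liftEdge [Algebra ℂ B] (S : Λ.KPFamily B) :
    RingQuot Λ.graph.LPRel →ₐ[ℂ] B :=
  RingQuot.liftAlgHom ℂ ⟨FreeAlgebra.lift ℂ S.onEdgeGen, by
    intro p q h
    induction h with
    | idem a =>
      simp only [map_mul, FreeAlgebra.lift_ι_apply]
      exact S.one_mul_one a
    | orth a b h =>
      simp only [map_mul, map_zero, FreeAlgebra.lift_ι_apply]
      exact S.orth a b h
    | r_real e =>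
      simp only [map_mul, FreeAlgebra.lift_ι_apply]
      exact S.one_mul_s (edgePath e)
    | real_s e =>
      simp only [map_mul, FreeAlgebra.lift_ι_apply]
      exact S.s_mul_one (edgePath e)
    | s_ghost e =>
      simp only [map_mul, FreeAlgebra.lift_ι_apply]
      exact S.one_mul_t (edgePath e)
    | ghost_r e =>
      simp only [map_mul, FreeAlgebra.lift_ι_apply]
      exact S.t_mul_one (edgePath e)
    | ghost_real e f =>
      by_cases hef : e = f
      · subst hef
        simp only [map_mul, if_true, FreeAlgebra.lift_ι_apply]
        exact S.t_mul_s_self (edgePath e)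
      · simp only [map_mul, if_neg hef, map_zero, FreeAlgebra.lift_ι_apply]
        exact S.t_mul_s_of_ne _ _ ((d_edgePath e).trans (d_edgePath f).symm)
          fun h => hef (edgePath_injective h)
    | sum a F hF _ =>
      have h1 := S.one_eq_sum a 1 (F.map ⟨edgePath, edgePath_injective⟩) (by
        ext c
        rw [Finset.mem_coe, Finset.mem_map]
        constructor
        · rintro ⟨e, he, rfl⟩
          exact ⟨(show e ∈ {e | Λ.graph.r e = a} from hF ▸ he), d_edgePath e⟩
        · rintro ⟨h1, h2⟩
          exact ⟨edge c h2, by rw [← Finset.mem_coe, hF]; exact h1, rfl⟩)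
      rw [Finset.sum_map] at h1
      simp only [map_sum, map_mul, FreeAlgebra.lift_ι_apply]
      exact h1⟩

variable (Λ) in
/-- A generator of the Leavitt path algebra, as an element of the unital algebra with the same
generators and relations. -/
noncomputable def lpGen (x : Λ.graph.LPGen) : RingQuot Λ.graph.LPRel :=
  RingQuot.mkAlgHom ℂ Λ.graph.LPRel (FreeAlgebra.ι ℂ x)

theorem lp_rel {p q : FreeAlgebra ℂ Λ.graph.LPGen} (h : Λ.graph.LPRel p q) :
    RingQuot.mkAlgHom ℂ Λ.graph.LPRel p = RingQuot.mkAlgHom ℂ Λ.graph.LPRel q :=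
  RingQuot.mkAlgHom_rel ℂ h

theorem KPFamily.liftEdge_lpGen [Algebra ℂ B] (S : Λ.KPFamily B) (x : Λ.graph.LPGen) :
    S.liftEdge (Λ.lpGen x) = S.onEdgeGen x := by
  simp [KPFamily.liftEdge, lpGen]

theorem lpGen_mul (x y : Λ.graph.LPGen) : Λ.lpGen x * Λ.lpGen y =
    RingQuot.mkAlgHom ℂ Λ.graph.LPRel (FreeAlgebra.ι ℂ x * FreeAlgebra.ι ℂ y) :=
  (map_mul _ _ _).symm

open scoped Classical in
/-- The universal edge family; the values `s a` and `t a` at paths that are not edges are junk. -/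
noncomputable def lpFamily (hns : Λ.NoSources) : Λ.EdgeFamily (RingQuot Λ.graph.LPRel) where
  p a := Λ.lpGen (.vert a)
  s a := if h : Λ.d a = 1 then Λ.lpGen (.real (edge a h)) else 0
  t a := if h : Λ.d a = 1 then Λ.lpGen (.ghost (edge a h)) else 0
  idem a := (lpGen_mul _ _).trans (lp_rel (.idem (E := Λ.graph) a))
  orth a b h := (lpGen_mul _ _).trans ((lp_rel (.orth (E := Λ.graph) a b h)).trans (map_zero _))
  p_mul_s e h := by
    rw [dif_pos h]
    exact (lpGen_mul _ _).trans (lp_rel (.r_real (edge e h)))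
  s_mul_p e h := by
    rw [dif_pos h]
    exact (lpGen_mul _ _).trans (lp_rel (.real_s (edge e h)))
  p_mul_t e h := by
    rw [dif_pos h]
    exact (lpGen_mul _ _).trans (lp_rel (.s_ghost (edge e h)))
  t_mul_p e h := by
    rw [dif_pos h]
    exact (lpGen_mul _ _).trans (lp_rel (.ghost_r (edge e h)))
  t_mul_s_self e h := by
    have h1 := lp_rel (.ghost_real (edge e h) (edge e h))
    rw [if_pos rfl] at h1
    rw [dif_pos h, dif_pos h]
    exact (lpGen_mul _ _).trans h1
  t_mul_s_of_ne e f he hf h := by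
    have h1 := lp_rel (.ghost_real (edge e he) (edge f hf))
    rw [if_neg fun h' => h (edge_inj h'), map_zero] at h1
    rw [dif_pos he, dif_pos hf]
    exact (lpGen_mul _ _).trans h1
  p_eq_sum a F hF := by
    have hF' : ∀ c, c ∈ F ↔ Λ.r c = a ∧ Λ.d c = 1 := fun c => by
      rw [← Finset.mem_coe, hF]; rfl
    let i : F ↪ Λ.graph.Edge := ⟨fun c => edge c.1 ((hF' c.1).1 c.2).2,
      fun c c' h => Subtype.ext (edge_inj h)⟩
    have h1 := lp_rel (.sum (E := Λ.graph) a (F.attach.map i) (by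
      ext e
      rw [Finset.mem_coe, Finset.mem_map]
      constructor
      · rintro ⟨c, -, rfl⟩
        exact ((hF' c.1).1 c.2).1
      · intro he
        exact ⟨⟨edgePath e, (hF' _).2 ⟨he, d_edgePath e⟩⟩, Finset.mem_attach _ _, rfl⟩) (by
      obtain ⟨e, he⟩ := hns a 1
      exact ⟨_, Finset.mem_map_of_mem i (Finset.mem_attach F ⟨e, (hF' e).2 he⟩)⟩))
    refine h1.trans ?_
    rw [map_sum, Finset.sum_map, ← Finset.sum_attach F]
    refine Finset.sum_congr rfl fun c _ => ?_
    have hc : Λ.d c.1 = 1 := ((hF' c.1).1 c.2).2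
    rw [dif_pos hc, dif_pos hc]
    exact (lpGen_mul _ _).symm

theorem exists_leavittPath_iso (hrf : Λ.RowFinite) (hns : Λ.NoSources) :
    ∃ φ : Λ.graph.LeavittPath ≃ₗ[ℂ] leavittGroupoidAlgebra Λ.PathGroupoid,
      Λ.groupoid.IsAlgebraIso φ ∧
      (∀ a : Λ.Vert, (φ (presentedAlgebra.gen _ (.vert a)) : Λ.PathGroupoid → ℂ) =
        (KGraph.cylinder (Λ.one a) (Λ.one a)).indicator 1) ∧
      (∀ e : Λ.graph.Edge, (φ (presentedAlgebra.gen _ (.real e)) : Λ.PathGroupoid → ℂ) =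
        (KGraph.cylinder e.1 (Λ.one (Λ.s e.1))).indicator 1) ∧
      (∀ e : Λ.graph.Edge, (φ (presentedAlgebra.gen _ (.ghost e)) : Λ.PathGroupoid → ℂ) =
        (KGraph.cylinder (Λ.one (Λ.s e.1)) e.1).indicator 1) := by
  let π : RingQuot Λ.graph.LPRel →ₐ[ℂ] Module.End ℂ Λ.PathSpace := (pathFamily Λ).liftEdge
  have hπ : ∀ x, π (Λ.lpGen x) = (pathFamily Λ).onEdgeGen x := (pathFamily Λ).liftEdge_lpGen
  let S := (lpFamily hns).toKPFamily hrf
  have hv : ∀ a, S.s (Λ.one a) = Λ.lpGen (.vert a) := (lpFamily hns).toKPFamily_s_one hrf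
  have hs : ∀ e (h : Λ.d e = 1), S.s e = Λ.lpGen (.real (edge e h)) := fun e h =>
    ((lpFamily hns).toKPFamily_s hrf h).trans (dif_pos h)
  have ht : ∀ e (h : Λ.d e = 1), S.t e = Λ.lpGen (.ghost (edge e h)) := fun e h =>
    ((lpFamily hns).toKPFamily_t hrf h).trans (dif_pos h)
  have hπs : ∀ a, π (S.s a) = realOp a := by
    refine path_induction (fun a => (congrArg π (hv a)).trans (hπ _)) fun e b h he hb => ?_
    rw [← S.s_mul_s e b h, map_mul, hb, hs e he, hπ]
    exact (pathFamily Λ).s_mul_s e b h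
  have hπt : ∀ a, π (S.t a) = ghostOp a := by
    refine path_induction (fun a => ?_) fun e b h he hb => ?_
    · rw [S.t_one, hv, hπ]
      exact ((pathFamily Λ).t_one a).symm
    · rw [← S.t_mul_t e b h, map_mul, hb, ht e he, hπ]
      exact (pathFamily Λ).t_mul_t e b h
  have hgen : ∀ x, Λ.lpGen x ∈ presentedAlgebra Λ.graph.LPRel := fun x =>
    NonUnitalAlgebra.subset_adjoin ℂ ⟨x, rfl⟩
  have hA : ∀ x, x ∈ presentedAlgebra Λ.graph.LPRel ↔ x ∈ S.span := by
    refine S.mem_adjoin_iff hrf ?_ ?_ ?_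
    · rintro _ ⟨x, rfl⟩
      cases x with
      | vert a => exact show Λ.lpGen (.vert a) ∈ S.span from hv a ▸ S.s_mem (Λ.one a)
      | real e => exact show Λ.lpGen (.real e) ∈ S.span from hs _ (d_edgePath e) ▸ S.s_mem _
      | ghost e => exact show Λ.lpGen (.ghost e) ∈ S.span from ht _ (d_edgePath e) ▸ S.t_mem _
    · refine path_induction (fun a => hv a ▸ hgen _) fun e b h he hb => ?_
      rw [← S.s_mul_s e b h, hs e he]
      exact MulMemClass.mul_mem (hgen _) hb
    · refine path_induction (fun a => S.t_one a ▸ hv a ▸ hgen _) fun e b h he hb => ?_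
      rw [← S.t_mul_t e b h, ht e he]
      exact MulMemClass.mul_mem hb (hgen _)
  obtain ⟨φ, h1, h2, h3, h4⟩ := exists_algebraIso hrf hns hπs hπt _ hA
  exact ⟨φ, h1, fun a => h2 a _ (hv a).symm, fun e => h3 _ _ (hs _ (d_edgePath e)).symm,
    fun e => h4 _ _ (ht _ (d_edgePath e)).symm⟩

end Leavitt

end KGraph

theorem proposition4p3 :
    (∀ (k : ℕ) (Λ : KGraph.{u, v} k), Λ.RowFinite → Λ.NoSources →
      ∃ φ : Λ.KumjianPask ≃ₗ[ℂ] leavittGroupoidAlgebra Λ.PathGroupoid,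
        Λ.groupoid.IsAlgebraIso φ ∧
        (∀ a, (φ (presentedAlgebra.gen _ (.vert a)) : Λ.PathGroupoid → ℂ) =
          (KGraph.cylinder (Λ.one a) (Λ.one a)).indicator 1) ∧
        (∀ lam, (φ (presentedAlgebra.gen _ (.real lam)) : Λ.PathGroupoid → ℂ) =
          (KGraph.cylinder lam (Λ.one (Λ.s lam))).indicator 1) ∧
        (∀ lam, (φ (presentedAlgebra.gen _ (.ghost lam)) : Λ.PathGroupoid → ℂ) =
          (KGraph.cylinder (Λ.one (Λ.s lam)) lam).indicator 1)) ∧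
    (∀ Λ : KGraph.{u, v} 1, Λ.RowFinite → Λ.NoSources →
      ∃ φ : Λ.graph.LeavittPath ≃ₗ[ℂ] leavittGroupoidAlgebra Λ.PathGroupoid,
        Λ.groupoid.IsAlgebraIso φ ∧
        (∀ a : Λ.Vert, (φ (presentedAlgebra.gen _ (.vert a)) : Λ.PathGroupoid → ℂ) =
          (KGraph.cylinder (Λ.one a) (Λ.one a)).indicator 1) ∧
        (∀ e : Λ.graph.Edge, (φ (presentedAlgebra.gen _ (.real e)) : Λ.PathGroupoid → ℂ) =
          (KGraph.cylinder e.1 (Λ.one (Λ.s e.1))).indicator 1) ∧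
        (∀ e : Λ.graph.Edge, (φ (presentedAlgebra.gen _ (.ghost e)) : Λ.PathGroupoid → ℂ) =
          (KGraph.cylinder (Λ.one (Λ.s e.1)) e.1).indicator 1)) := by
  exact ⟨fun _ _ hrf hns => KGraph.exists_kumjianPask_iso hrf hns,
    fun _ hrf hns => KGraph.exists_leavittPath_iso hrf hns⟩
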